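/- Let $n\ge 1$, let $\alpha_1,\dots,\alpha_n\in(0,\pi)$ be the angles and $\ell_1,\dots,\ell_n>0$ the side lengths of a curvilinear polygon $\mathcal P$: the side $I_j$ of length $\ell_j$ joins the vertices $V_{j-1}$ and $V_j$, the angle at $V_j$ is $\alpha_j$, and indices are cyclic modulo $n$. An angle is called exceptional if it equals $\pi/(2k)$ for some integer $k\ge1$; its parity is then $\mathcal O(\alpha)=\cos\frac{\pi^2}{2\alpha}=(-1)^k$. *Quasi-eigenvalues.* For $\sigma\in\mathbb R$ put $$\mathtt A(\alpha)=\begin{pmatrix}\csc\frac{\pi^2}{2\alpha}&-\mathrm i\cot\frac{\pi^2}{2\alpha}\\ \mathrm i\cot\frac{\pi^2}{2\alpha}&\csc\frac{\pi^2}{2\alpha}\end{pmatrix}\ (\alpha\text{ not exceptional}),\qquad \mathtt B(\ell,\sigma)=\begin{pmatrix}\mathrm e^{\mathrm i\ell\sigma}&0\\0&\mathrm e^{-\mathrm i\ell\sigma}\end{pmatrix}.$$ (a) If no angle is exceptional, let $\mathtt T(\sigma)=\mathtt A(\alpha_n)\mathtt B(\ell_n,\sigma)\cdots\mathtt A(\alpha_1)\mathtt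 B(\ell_1,\sigma)$. A number $\sigma\ge0$ is a quasi-eigenvalue if $1$ is an eigenvalue of $\mathtt T(\sigma)$. Its multiplicity is the geometric multiplicity of this eigenvalue if $\sigma>0$, and is one if $\sigma=0$. (b) If there are exceptional angles, they split the boundary into exceptional components. Each of them goes, in the direction of increasing index, from an exceptional vertex $V_s$ along the sides $I_{s+1},\dots,I_{s+m}$ to the next exceptional vertex $V_{s+m}$, $m\ge1$ (possibly $V_{s+m}=V_s$ with $m=n$). Let $\mathbf X(\alpha)=\frac1{\sqrt2}\binom{\mathrm e^{-\mathrm i\pi/4}}{\mathrm e^{\mathrm i\pi/4}}$ if $\mathcal O(\alpha)=1$ and $\mathbf X(\alpha)=\frac1{\sqrt2}\binom{\mathrm e^{\mathrm i\pi/4}}{\mathrm e^{-\mathrm i\pi/4}}$ if $\mathcal O(\alpha)=-1$, and let $\mathtt U_s(\sigma)=\mathtt B(\ell_{s+m},\sigma)\mathtt A(\alpha_{s+m-1})\mathtt B(\ell_{s+m-1},\sigma)\cdots\mathtt A(\alpha_{s+1})\mathtt B(\ell_{s+1},\sigma)$. A number $\sigma\ge0$ is a quasi-eigenvalue if $$\mathtt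 U_s(\sigma)\mathbf X(\alpha_s)\cdot\mathbf X(\alpha_{s+m})=0\qquad(u\cdot v=u_1\overline{v_1}+u_2\overline{v_2})$$ for at least one exceptional component. Its multiplicity is the number of components for which this holds if $\sigma>0$, and is half the number of components whose two end vertices have different parities if $\sigma=0$. *Quantum graph.* Let $\mathcal G$ be the cyclic metric graph with the vertices $V_j$ and the edges $I_j$, with arc length $s$ increasing from $V_{j-1}$ to $V_j$ on $I_j$. Let $\Delta_{\mathcal G}$ be the operator $f\mapsto-\frac{\mathrm d^2f}{\mathrm ds^2}$ in $L^2(\mathcal G)$ whose domain consists of the functions that are in $H^2$ on every edge and satisfy, for $j=1,\dots,n$, the matching conditions $$\sin\Bigl(\tfrac{\pi^2}{4\alpha_j}\Bigr)f|_{V_j+0}=\cos\Bigl(\tfrac{\pi^2}{4\alpha_j}\Bigr)f|_{V_j-0},\qquad \cos\Bigl(\tfrac{\pi^2}{4\alpha_j}\Bigr)f'|_{V_j+0}=\sin\Bigl(\tfrac{\pi^2}{4\alpha_j}\Bigr)f'|_{V_j-0},$$ where $V_j-0$ and $V_j+0$ denote the limits at $V_j$ along $I_j$ and along $I_{j+1}$,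 respectively. **Theorem.** The quasi-eigenvalues of $\mathcal P$, repeated according to multiplicity, form an infinite non-decreasing sequence $\sigma_1\le\sigma_2\le\cdots$; the eigenvalues of $\Delta_{\mathcal G}$ are real and, repeated according to multiplicity, form an infinite non-decreasing sequence $\nu_1\le\nu_2\le\cdots\to+\infty$; and $\sigma_m^2=\nu_m$ for all $m\ge1$. -/

import Mathlib

open MeasureTheory Matrix

noncomputable section

namespace SteklovPolygon

/-! ### Angles, transfer matrices -/

/-- An angle is exceptional if it equals `π / (2k)` for some integer `k ≥ 1`. -/
def IsExceptional (a : ℝ) : Prop := ∃ k : ℕ, 1 ≤ k ∧ a = Real.pi / (2 * k)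

/-- `μ_α = π² / (2α)`. -/
def angleMu (a : ℝ) : ℝ := Real.pi ^ 2 / (2 * a)

/-- The parity `cos (π² / (2α))` of an exceptional angle: `(-1)^k` if `α = π / (2k)`. -/
def parity (a : ℝ) : ℝ := Real.cos (angleMu a)

/-- The vertex transfer matrix of a non-exceptional angle
(never used below at exceptional angles, where its entries blow up). -/
def vertexMatrix (a : ℝ) : Matrix (Fin 2) (Fin 2) ℂ :=
  let a₁ : ℂ := ((1 / Real.sin (angleMu a) : ℝ) : ℂ)
  let a₂ : ℂ := ((Real.cos (angleMu a) / Real.sin (angleMu a) : ℝ) : ℂ)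
  !![a₁, -Complex.I * a₂; Complex.I * a₂, a₁]

/-- The side transfer matrix of a side of length `l`. -/
def sideMatrix (l σ : ℝ) : Matrix (Fin 2) (Fin 2) ℂ :=
  !![Complex.exp (Complex.I * l * σ), 0; 0, Complex.exp (-(Complex.I * l * σ))]

/-- `T = A(α_n) B(ℓ_n) ⋯ A(α_1) B(ℓ_1)`; the indices `1, …, n` are the elements of `Fin n`. -/
def polygonMatrix {n : ℕ} (α ℓ : Fin n → ℝ) (σ : ℝ) : Matrix (Fin 2) (Fin 2) ℂ :=
  (List.ofFn fun j : Fin n => vertexMatrix (α j) * sideMatrix (ℓ j) σ).reverse.prod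

/-! ### Exceptional boundary components -/

def xEven : Fin 2 → ℂ :=
  (1 / (Real.sqrt 2 : ℂ)) •
    ![Complex.exp (-(Complex.I * Real.pi / 4)), Complex.exp (Complex.I * Real.pi / 4)]

def xOdd : Fin 2 → ℂ :=
  (1 / (Real.sqrt 2 : ℂ)) •
    ![Complex.exp (Complex.I * Real.pi / 4), Complex.exp (-(Complex.I * Real.pi / 4))]

open Classical in
/-- The vector attached to an exceptional angle (whose parity is `1` or `-1`). -/
def xVec (a : ℝ) : Fin 2 → ℂ := if parity a = 1 then xEven else xOdd

/-- The vertex (or side) reached from the index `s` after `m` steps around the polygon. -/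
def step {n : ℕ} [NeZero n] (s : Fin n) (m : ℕ) : Fin n := s + Fin.ofNat n m

/-- For an exceptional vertex `s`, the number of sides of the exceptional component that starts
at `s`: the least `m ≥ 1` such that the vertex `m` steps after `s` is exceptional. Since one
returns to `s` after `n` steps, such an `m` exists and is at most `n`. -/
def compSize {n : ℕ} [NeZero n] (α : Fin n → ℝ) (s : Fin n) : ℕ :=
  sInf {m : ℕ | 1 ≤ m ∧ IsExceptional (α (step s m))}

/-- The exceptional vertex at which the exceptional component starting at `s` ends. -/
def nextExceptional {n : ℕ} [NeZero n] (α : Fin n → ℝ) (s : Fin n) : Fin n :=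
  step s (compSize α s)

/-- The transfer matrix along the `m + 1` sides `s+1, …, s+m+1` and through the `m` vertices
between them: `B(ℓ_{s+m+1}) A(α_{s+m}) B(ℓ_{s+m}) ⋯ A(α_{s+1}) B(ℓ_{s+1})`. -/
def pathMatrix {n : ℕ} [NeZero n] (α ℓ : Fin n → ℝ) (σ : ℝ) (s : Fin n) :
    ℕ → Matrix (Fin 2) (Fin 2) ℂ
  | 0 => sideMatrix (ℓ (step s 1)) σ
  | m + 1 => sideMatrix (ℓ (step s (m + 2))) σ * vertexMatrix (α (step s (m + 1))) *
      pathMatrix α ℓ σ s m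

/-- The matrix `U` of the exceptional component that starts at the exceptional vertex `s`. -/
def componentMatrix {n : ℕ} [NeZero n] (α ℓ : Fin n → ℝ) (σ : ℝ) (s : Fin n) :
    Matrix (Fin 2) (Fin 2) ℂ :=
  pathMatrix α ℓ σ s (compSize α s - 1)

/-- The quasi-eigenvalue equation `U X(start) · X(end) = 0` on the exceptional component that
starts at `s`; the dot product is the Hermitian one, `u · v = ∑ uᵢ conj vᵢ`. -/
def SolvesComponent {n : ℕ} [NeZero n] (α ℓ : Fin n → ℝ) (σ : ℝ) (s : Fin n) : Prop :=
  (componentMatrix α ℓ σ s *ᵥ xVec (α s)) ⬝ᵥ star (xVec (α (nextExceptional α s))) = 0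

/-! ### Quasi-eigenvalues and their multiplicities -/

open Classical in
/-- `σ` is a Steklov quasi-eigenvalue of the polygon with angles `α` and side lengths `ℓ`. -/
def IsQuasiEigenvalue {n : ℕ} [NeZero n] (α ℓ : Fin n → ℝ) (σ : ℝ) : Prop :=
  0 ≤ σ ∧
    if ∃ j, IsExceptional (α j) then
      ∃ s, IsExceptional (α s) ∧ SolvesComponent α ℓ σ s
    else
      Module.End.HasEigenvalue (Matrix.toLin' (polygonMatrix α ℓ σ)) 1

open Classical in
/-- The multiplicity of `σ` as a quasi-eigenvalue (`0` if `σ` is none). Exceptional components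
are indexed by the exceptional vertices at which they start; those whose two end vertices have
different parities (the odd ones) are even in number. -/
def quasiMultiplicity {n : ℕ} [NeZero n] (α ℓ : Fin n → ℝ) (σ : ℝ) : ℕ :=
  if IsQuasiEigenvalue α ℓ σ then
    if ∃ j, IsExceptional (α j) then
      if σ = 0 then
        {s : Fin n | IsExceptional (α s) ∧
          parity (α s) ≠ parity (α (nextExceptional α s))}.ncard / 2
      else
        {s : Fin n | IsExceptional (α s) ∧ SolvesComponent α ℓ σ s}.ncard
    else
      if σ = 0 then 1
      else Module.finrank ℂ (Module.End.eigenspace (Matrix.toLin' (polygonMatrix α ℓ σ)) 1)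
  else 0

/-- `σ 0 ≤ σ 1 ≤ …` lists the quasi-eigenvalues with multiplicities. -/
def IsQuasiEigenvalueSeq {n : ℕ} [NeZero n] (α ℓ : Fin n → ℝ) (σ : ℕ → ℝ) : Prop :=
  Monotone σ ∧ ∀ x : ℝ, {m | σ m = x}.encard = quasiMultiplicity α ℓ x

/-! ### The quantum graph Laplacian

The `j`-th edge, which joins the vertices `j - 1` and `j`, is parametrised by arc length over
`[0, ℓ j]`, so that `0` corresponds to the right side `V_{j-1} + 0` of the vertex `j - 1` and
`ℓ j` to the left side `V_j - 0` of the vertex `j`. -/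

/-- The Hilbert space `L²(𝒢) = ⨁ L²(0, ℓ j)`. -/
abbrev GraphL2 {n : ℕ} (ℓ : Fin n → ℝ) : Type :=
  PiLp 2 fun j : Fin n => Lp ℂ 2 (volume.restrict (Set.Ioo 0 (ℓ j)))

/-- `f` is the absolutely continuous representative on `[0, L]` of a function in `H¹(0, L)`
whose derivative is `g ∈ L²(0, L)`. -/
def IsH1 (L : ℝ) (f g : ℝ → ℂ) : Prop :=
  MemLp g 2 (volume.restrict (Set.Ioo 0 L)) ∧
    ∀ x ∈ Set.Icc 0 L, f x = f 0 + ∫ t in (0 : ℝ)..x, g t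

/-- The matching conditions at the vertices, for a function `f` on the graph with edgewise
derivative `f'`. -/
def Matching {n : ℕ} [NeZero n] (α ℓ : Fin n → ℝ) (f f' : Fin n → ℝ → ℂ) : Prop :=
  ∀ j : Fin n,
    (Real.sin (Real.pi ^ 2 / (4 * α j)) : ℂ) * f (j + 1) 0 =
        (Real.cos (Real.pi ^ 2 / (4 * α j)) : ℂ) * f j (ℓ j) ∧
    (Real.cos (Real.pi ^ 2 / (4 * α j)) : ℂ) * f' (j + 1) 0 =
        (Real.sin (Real.pi ^ 2 / (4 * α j)) : ℂ) * f' j (ℓ j)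

/-- `u` belongs to the domain of the quantum graph Laplacian (it is in `H²` on every edge and
satisfies the matching conditions) and is mapped to `w = -u''`. -/
def LaplacianRel {n : ℕ} [NeZero n] (α ℓ : Fin n → ℝ) (u w : GraphL2 ℓ) : Prop :=
  ∃ f f' f'' : Fin n → ℝ → ℂ,
    (∀ j, IsH1 (ℓ j) (f j) (f' j) ∧ IsH1 (ℓ j) (f' j) (f'' j)) ∧
    Matching α ℓ f f' ∧
    ∀ j, (u j : ℝ → ℂ) =ᵐ[volume.restrict (Set.Ioo 0 (ℓ j))] f j ∧
      (w j : ℝ → ℂ) =ᵐ[volume.restrict (Set.Ioo 0 (ℓ j))] fun x => -f'' j x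

theorem IsH1.intervalIntegrable {L : ℝ} {f g : ℝ → ℂ} (h : IsH1 L f g) {x : ℝ}
    (hx : x ∈ Set.Icc 0 L) : IntervalIntegrable g volume 0 x := by
  have h1 : Integrable g (volume.restrict (Set.Ioo 0 L)) := h.1.integrable (by norm_num)
  rw [intervalIntegrable_iff_integrableOn_Ioo_of_le hx.1]
  exact IntegrableOn.mono_set h1 (Set.Ioo_subset_Ioo_right hx.2)

theorem IsH1.add {L : ℝ} {f g f₂ g₂ : ℝ → ℂ} (h : IsH1 L f g) (h₂ : IsH1 L f₂ g₂) :
    IsH1 L (f + f₂) (g + g₂) := by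
  refine ⟨h.1.add h₂.1, fun x hx => ?_⟩
  simp only [Pi.add_apply]
  rw [intervalIntegral.integral_add (h.intervalIntegrable hx) (h₂.intervalIntegrable hx),
    h.2 x hx, h₂.2 x hx]
  ring

theorem IsH1.smul {L : ℝ} {f g : ℝ → ℂ} (c : ℂ) (h : IsH1 L f g) :
    IsH1 L (c • f) (c • g) := by
  refine ⟨h.1.const_smul c, fun x hx => ?_⟩
  simp only [Pi.smul_apply]
  rw [intervalIntegral.integral_smul, h.2 x hx, smul_add]

/-- The graph of the quantum graph Laplacian. -/
def laplacianGraph {n : ℕ} [NeZero n] (α ℓ : Fin n → ℝ) :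
    Submodule ℂ (GraphL2 ℓ × GraphL2 ℓ) where
  carrier := {p | LaplacianRel α ℓ p.1 p.2}
  zero_mem' := by
    refine ⟨0, 0, 0, fun j => ⟨⟨?_, ?_⟩, ⟨?_, ?_⟩⟩, fun j => ?_, fun j => ⟨?_, ?_⟩⟩
    · exact MemLp.zero
    · simp
    · exact MemLp.zero
    · simp
    · simp
    · exact Lp.coeFn_zero _ _ _
    · filter_upwards [Lp.coeFn_zero ℂ 2 (volume.restrict (Set.Ioo 0 (ℓ j)))] with x hx
      simpa using hx
  add_mem' := by
    rintro p q ⟨f, f', f'', h, hm, hu⟩ ⟨g, g', g'', k, km, ku⟩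
    refine ⟨f + g, f' + g', f'' + g'', fun j => ⟨(h j).1.add (k j).1, (h j).2.add (k j).2⟩,
      fun j => ⟨?_, ?_⟩, fun j => ⟨?_, ?_⟩⟩
    · simp only [Pi.add_apply, mul_add, (hm j).1, (km j).1]
    · simp only [Pi.add_apply, mul_add, (hm j).2, (km j).2]
    · filter_upwards [Lp.coeFn_add (p.1 j) (q.1 j), (hu j).1, (ku j).1] with x h1 h2 h3
      simpa [h2, h3] using h1
    · filter_upwards [Lp.coeFn_add (p.2 j) (q.2 j), (hu j).2, (ku j).2] with x h1 h2 h3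
      simp only [Pi.add_apply, h2, h3] at h1
      simp only [Prod.snd_add, PiLp.add_apply, h1, Pi.add_apply]
      ring
  smul_mem' := by
    rintro c p ⟨f, f', f'', h, hm, hu⟩
    refine ⟨c • f, c • f', c • f'', fun j => ⟨(h j).1.smul c, (h j).2.smul c⟩,
      fun j => ⟨?_, ?_⟩, fun j => ⟨?_, ?_⟩⟩
    · simp only [Pi.smul_apply, mul_smul_comm, (hm j).1]
    · simp only [Pi.smul_apply, mul_smul_comm, (hm j).2]
    · filter_upwards [Lp.coeFn_smul c (p.1 j), (hu j).1] with x h1 h2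
      simpa [h2] using h1
    · filter_upwards [Lp.coeFn_smul c (p.2 j), (hu j).2] with x h1 h2
      simp only [Pi.smul_apply, h2] at h1
      simp only [Prod.smul_snd, PiLp.smul_apply, h1, Pi.smul_apply, smul_neg]

/-- The derivative of an `H¹` function that vanishes almost everywhere vanishes almost
everywhere. -/
theorem IsH1.ae_zero {L : ℝ} {f g : ℝ → ℂ} (h : IsH1 L f g)
    (hf : f =ᵐ[volume.restrict (Set.Ioo 0 L)] 0) :
    g =ᵐ[volume.restrict (Set.Ioo 0 L)] 0 := by
  rcases le_or_gt L 0 with hL | hL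
  · simp [Set.Ioo_eq_empty_of_le hL, Filter.EventuallyEq]
  have hint := h.intervalIntegrable (Set.right_mem_Icc.2 hL.le)
  have hc : ContinuousOn f (Set.Icc 0 L) := by
    have h1 := intervalIntegral.continuousOn_primitive_interval' hint Set.left_mem_uIcc
    rw [Set.uIcc_of_le hL.le] at h1
    exact (continuousOn_const.add h1).congr h.2
  have hz : Set.EqOn f 0 (Set.Ioo 0 L) :=
    Measure.eqOn_open_of_ae_eq hf isOpen_Ioo (hc.mono Set.Ioo_subset_Icc_self)
      continuousOn_const
  have hd := hint.ae_hasDerivAt_integral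
  rw [Filter.EventuallyEq, ae_restrict_iff' measurableSet_Ioo]
  filter_upwards [hd] with x hx hxm
  have hxI : x ∈ Set.uIcc 0 L := by
    rw [Set.uIcc_of_le hL.le]; exact Set.Ioo_subset_Icc_self hxm
  have h1 := hx hxI 0 Set.left_mem_uIcc
  have h2 : (fun y => ∫ t in (0 : ℝ)..y, g t) =ᶠ[nhds x] fun _ => -f 0 := by
    filter_upwards [isOpen_Ioo.mem_nhds hxm] with y hy
    have h3 := h.2 y (Set.Ioo_subset_Icc_self hy)
    rw [hz hy] at h3
    exact (neg_eq_of_add_eq_zero_right h3.symm).symm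
  exact h1.unique ((hasDerivAt_const x (-f 0)).congr_of_eventuallyEq h2)

/-- The quantum graph Laplacian `f ↦ -f''` as an unbounded operator in `L²(𝒢)`. -/
def graphLaplacian {n : ℕ} [NeZero n] (α ℓ : Fin n → ℝ) : GraphL2 ℓ →ₗ.[ℂ] GraphL2 ℓ :=
  (laplacianGraph α ℓ).toLinearPMap

/-- The relation `LaplacianRel` is single-valued, hence is exactly the graph of the operator. -/
theorem graphLaplacian_graph {n : ℕ} [NeZero n] (α ℓ : Fin n → ℝ) :
    (graphLaplacian α ℓ).graph = laplacianGraph α ℓ := by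
  apply Submodule.toLinearPMap_graph_eq
  rintro ⟨u, w⟩ ⟨f, f', f'', h, -, hu⟩ (rfl : u = 0)
  ext j
  have h0 : f j =ᵐ[volume.restrict (Set.Ioo 0 (ℓ j))] 0 :=
    (hu j).1.symm.trans (Lp.coeFn_zero _ _ _)
  filter_upwards [(h j).2.ae_zero ((h j).1.ae_zero h0), (hu j).2,
    Lp.coeFn_zero ℂ 2 (volume.restrict (Set.Ioo 0 (ℓ j)))] with x h1 h2 h3
  simp only [h2, h1, Pi.zero_apply, neg_zero]
  exact h3.symm

/-- The eigenspace `{u ∈ Dom T | T u = z u}` of an unbounded operator. -/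
def eigenspace {H : Type*} [AddCommGroup H] [Module ℂ H] (T : H →ₗ.[ℂ] H) (z : ℂ) :
    Submodule ℂ H :=
  T.graph.comap (LinearMap.id.prod (z • LinearMap.id))

/-- `ν 0 ≤ ν 1 ≤ …` lists all (complex) eigenvalues of `T` with their geometric multiplicities;
in particular all of them are real. -/
def IsEigenvalueSeq {H : Type*} [AddCommGroup H] [Module ℂ H] (T : H →ₗ.[ℂ] H)
    (ν : ℕ → ℝ) : Prop :=
  Monotone ν ∧
    ∀ z : ℂ, {m | (ν m : ℂ) = z}.encard = Cardinal.toENat (Module.rank ℂ (eigenspace T z))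

end SteklovPolygon

end

noncomputable section

namespace SteklovPolygon

/-! ### Solutions of `-f'' = z f` on an edge -/

/-! On an edge, a solution of -f'' = σ² f is fixed by its value and derivative at the left end.
Hence the eigenspace to σ² is isomorphic to `coefSpace`, the finite-dimensional space of initial
data compatible with the matching conditions (`eigenspace_eq_map`). These conditions preserve f' f̄
across every vertex, so Green's formula has no boundary terms and all eigenvalues are real and
nonnegative (`eigenspace_eq_bot`). What remains is the equality of dim `coefSpace` with
`quasiMultiplicity` for each σ ≥ 0 (`finrank_coefSpace`).

For σ > 0, replace initial data by the amplitudes of the waves e^{±iσx}. Propagation along a side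
becomes B(ℓ, σ). At a non-exceptional vertex the value is multiplied by cot(μ/2) and the derivative
by tan(μ/2), where μ = π²/(2α); these numbers are csc μ ± cot μ, which makes the matching matrix
A(α). If no angle is exceptional, eigenfunctions are therefore the fixed vectors of T(σ). At an
exceptional vertex the sine or the cosine vanishes, and matching splits into a Dirichlet condition
on one side and a Neumann condition on the other. The components decouple, and each contributes one
dimension exactly when its equation UX·X = 0 holds.

For σ = 0, monotonicity of f' f̄ along the edges forces eigenfunctions to be constant on each edge.
Without exceptional angles such a function exists, uniquely up to scalars, when the product of the
jumps is 1. With them, a component carries a nonzero constant exactly when it runs from an even to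
an odd vertex; these are half of the components whose ends have different parities.

Infinitude comes from a phase argument: a real wave carried around has a continuous phase that is
bounded below by a line of positive slope in σ, since vertices change it by bounded amounts.
Discreteness comes from analyticity in σ of the component equations and of tr T(σ) - 2. The
resulting multiplicities can be listed by a monotone sequence, and they determine it
(`exists_monotone_encard_eq`, `eq_of_encard_eq`). -/

theorem IsH1.continuousOn {L : ℝ} (hL : 0 < L) {f g : ℝ → ℂ} (h : IsH1 L f g) :
    ContinuousOn f (Set.Icc 0 L) := by
  have h1 := intervalIntegral.continuousOn_primitive_interval'
    (h.intervalIntegrable (Set.right_mem_Icc.2 hL.le)) Set.left_mem_uIcc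
  rw [Set.uIcc_of_le hL.le] at h1
  exact (continuousOn_const.add h1).congr h.2

theorem IsH1.congr_deriv {L : ℝ} {f g g₂ : ℝ → ℂ} (h : IsH1 L f g)
    (hg : g =ᵐ[volume.restrict (Set.Ioo 0 L)] g₂) : IsH1 L f g₂ := by
  refine ⟨(memLp_congr_ae hg).1 h.1, fun x hx => ?_⟩
  rw [h.2 x hx]
  congr 1
  rw [intervalIntegral.integral_of_le hx.1, intervalIntegral.integral_of_le hx.1,
    integral_Ioc_eq_integral_Ioo, integral_Ioc_eq_integral_Ioo]
  exact integral_congr_ae (ae_restrict_of_ae_restrict_of_subset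
    (Set.Ioo_subset_Ioo_right hx.2) hg)

theorem IsH1.hasDerivAt {L : ℝ} {f g : ℝ → ℂ} (h : IsH1 L f g)
    (hg : ContinuousOn g (Set.Icc 0 L)) {x : ℝ} (hx : x ∈ Set.Ioo 0 L) :
    HasDerivAt f (g x) x := by
  have hx' := Set.Ioo_subset_Icc_self hx
  have hgo : ContinuousOn g (Set.Ioo 0 L) := hg.mono Set.Ioo_subset_Icc_self
  have h1 : HasDerivAt (fun y => ∫ t in (0 : ℝ)..y, g t) (g x) x :=
    intervalIntegral.integral_hasDerivAt_right (h.intervalIntegrable hx')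
      (hgo.stronglyMeasurableAtFilter isOpen_Ioo x hx)
      (hgo.continuousAt (isOpen_Ioo.mem_nhds hx))
  refine (h1.const_add (f 0)).congr_of_eventuallyEq ?_
  filter_upwards [isOpen_Ioo.mem_nhds hx] with y hy
  exact h.2 y (Set.Ioo_subset_Icc_self hy)

theorem memLp_Ioo_of_continuous {g : ℝ → ℂ} (hg : Continuous g) (L : ℝ) :
    MemLp g 2 (volume.restrict (Set.Ioo 0 L)) := by
  obtain ⟨C, hC⟩ := isCompact_Icc.exists_bound_of_continuousOn (s := Set.Icc 0 L) hg.continuousOn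
  refine MemLp.of_bound hg.aestronglyMeasurable C ?_
  filter_upwards [ae_restrict_mem measurableSet_Ioo] with x hx
  exact hC x (Set.Ioo_subset_Icc_self hx)

theorem isH1_of_hasDerivAt {L : ℝ} {f g : ℝ → ℂ} (h : ∀ x, HasDerivAt f (g x) x)
    (hg : Continuous g) : IsH1 L f g := by
  constructor
  · exact memLp_Ioo_of_continuous hg L
  · intro x _
    rw [intervalIntegral.integral_eq_sub_of_hasDerivAt (fun y _ => h y)
      (hg.intervalIntegrable _ _)]
    ring

/-- The odd fundamental solution of `-f'' = σ² f`. -/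
def sn (σ x : ℝ) : ℝ := if σ = 0 then x else Real.sin (σ * x) / σ

theorem sn_zero_right (σ : ℝ) : sn σ 0 = 0 := by simp [sn]

theorem hasDerivAt_sn (σ x : ℝ) : HasDerivAt (sn σ) (Real.cos (σ * x)) x := by
  by_cases h : σ = 0
  · have : sn σ = fun x => x := by ext; simp [sn, h]
    rw [this]; simpa [h] using hasDerivAt_id' x
  · have : sn σ = fun x => Real.sin (σ * x) / σ := by ext; simp [sn, h]
    rw [this]
    have := (((hasDerivAt_id' x).const_mul σ).sin).div_const σ
    simpa [h] using this

theorem hasDerivAt_cos_mul (σ x : ℝ) :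
    HasDerivAt (fun x => Real.cos (σ * x)) (-(σ ^ 2 * sn σ x)) x := by
  have := ((hasDerivAt_id' x).const_mul σ).cos
  by_cases h : σ = 0
  · simpa [h] using this
  · convert this using 1
    simp [sn, h]; field_simp

theorem cos_sq_add_sn_sq (σ x : ℝ) : Real.cos (σ * x) ^ 2 + σ ^ 2 * sn σ x ^ 2 = 1 := by
  by_cases h : σ = 0
  · simp [h]
  · simp [sn, h]; field_simp; exact Real.cos_sq_add_sin_sq _

/-- The solution of `-f'' = σ² f` with `f 0 = v 0` and `f' 0 = v 1`. -/
def sol (σ : ℝ) (v : Fin 2 → ℂ) (x : ℝ) : ℂ := v 0 * Real.cos (σ * x) + v 1 * sn σ x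

/-- The derivative of `sol`. -/
def sol' (σ : ℝ) (v : Fin 2 → ℂ) (x : ℝ) : ℂ :=
  v 1 * Real.cos (σ * x) - v 0 * (σ ^ 2 * sn σ x)

theorem hasDerivAt_sol (σ : ℝ) (v : Fin 2 → ℂ) (x : ℝ) :
    HasDerivAt (sol σ v) (sol' σ v x) x := by
  have h1 := ((hasDerivAt_cos_mul σ x).ofReal_comp).const_mul (v 0)
  have h2 := ((hasDerivAt_sn σ x).ofReal_comp).const_mul (v 1)
  refine (h1.add h2).congr_deriv ?_
  simp only [sol']; push_cast; ring

theorem hasDerivAt_sol' (σ : ℝ) (v : Fin 2 → ℂ) (x : ℝ) :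
    HasDerivAt (sol' σ v) (-(σ ^ 2 * sol σ v x)) x := by
  have h1 := ((hasDerivAt_cos_mul σ x).ofReal_comp).const_mul (v 1)
  have h2 := (((hasDerivAt_sn σ x).ofReal_comp).const_mul ((σ : ℂ) ^ 2)).const_mul (v 0)
  refine (h1.sub h2).congr_deriv ?_
  simp only [sol]; push_cast; ring

theorem continuous_sol (σ : ℝ) (v : Fin 2 → ℂ) : Continuous (sol σ v) :=
  continuous_iff_continuousAt.2 fun x => (hasDerivAt_sol σ v x).continuousAt

theorem continuous_sol' (σ : ℝ) (v : Fin 2 → ℂ) : Continuous (sol' σ v) :=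
  continuous_iff_continuousAt.2 fun x => (hasDerivAt_sol' σ v x).continuousAt

theorem sol_zero_right (σ : ℝ) (v : Fin 2 → ℂ) : sol σ v 0 = v 0 := by
  simp [sol, sn_zero_right]

theorem sol'_zero_right (σ : ℝ) (v : Fin 2 → ℂ) : sol' σ v 0 = v 1 := by
  simp [sol', sn_zero_right]

/-- Uniqueness for the initial value problem `-f'' = σ² f`. -/
theorem eqOn_sol {L σ : ℝ} (hL : 0 < L) {f g : ℝ → ℂ} (hf : IsH1 L f g)
    (hg : IsH1 L g fun x => -(σ ^ 2 * f x)) {x : ℝ} (hx : x ∈ Set.Icc 0 L) :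
    f x = sol σ ![f 0, g 0] x ∧ g x = sol' σ ![f 0, g 0] x := by
  have cf := hf.continuousOn hL
  have cg := hg.continuousOn hL
  have df : ∀ y ∈ Set.Ioo 0 L, HasDerivAt f (g y) y := fun y hy => hf.hasDerivAt cg hy
  have dg : ∀ y ∈ Set.Ioo 0 L, HasDerivAt g (-(σ ^ 2 * f y)) y := fun y hy =>
    hg.hasDerivAt (by fun_prop) hy
  have cC : ContinuousOn (fun x => ((Real.cos (σ * x) : ℝ) : ℂ)) (Set.Icc 0 L) := by fun_prop
  have cS : ContinuousOn (fun x => ((sn σ x : ℝ) : ℂ)) (Set.Icc 0 L) := by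
    have : Continuous (sn σ) :=
      continuous_iff_continuousAt.2 fun x => (hasDerivAt_sn σ x).continuousAt
    fun_prop
  have sub : Set.Icc 0 x ⊆ Set.Icc 0 L := Set.Icc_subset_Icc_right hx.2
  -- The two Wronskian-type expressions f cos - g sn and σ² f sn + g cos have zero derivative. Since
  -- cos² + σ² sn² = 1, their constancy can be solved for f and g.
  have hA := intervalIntegral.integral_eq_sub_of_hasDerivAt_of_le (f' := fun _ => (0 : ℂ)) hx.1
    (((cf.mul cC).sub (cg.mul cS)).mono sub) (fun y hy => by
      have hy' : y ∈ Set.Ioo 0 L := ⟨hy.1, hy.2.trans_le hx.2⟩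
      have h := ((df y hy').mul (hasDerivAt_cos_mul σ y).ofReal_comp).sub
        ((dg y hy').mul (hasDerivAt_sn σ y).ofReal_comp)
      refine h.congr_deriv ?_
      push_cast; ring) (by simp)
  have hB := intervalIntegral.integral_eq_sub_of_hasDerivAt_of_le (f' := fun _ => (0 : ℂ)) hx.1
    ((((continuousOn_const (c := (σ : ℂ) ^ 2)).mul (cf.mul cS)).add (cg.mul cC)).mono sub)
    (fun y hy => by
      have hy' : y ∈ Set.Ioo 0 L := ⟨hy.1, hy.2.trans_le hx.2⟩
      have h := (((df y hy').mul (hasDerivAt_sn σ y).ofReal_comp).const_mul ((σ : ℂ) ^ 2)).add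
        ((dg y hy').mul (hasDerivAt_cos_mul σ y).ofReal_comp)
      refine h.congr_deriv ?_
      push_cast; ring) (by simp)
  have h1 : ((Real.cos (σ * x) : ℝ) : ℂ) ^ 2 + (σ : ℂ) ^ 2 * (sn σ x : ℂ) ^ 2 = 1 := by
    exact_mod_cast cos_sq_add_sn_sq σ x
  simp only [intervalIntegral.integral_zero, Pi.sub_apply, Pi.mul_apply, Pi.add_apply,
    sn_zero_right, mul_zero, Real.cos_zero, Complex.ofReal_zero, Complex.ofReal_one,
    mul_one, sub_zero, zero_add] at hA hB
  constructor
  · simp only [sol, cons_val_zero, cons_val_one]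
    linear_combination (-f x) * h1 - (Real.cos (σ * x) : ℂ) * hA - (sn σ x : ℂ) * hB
  · simp only [sol', cons_val_zero, cons_val_one]
    linear_combination (-g x) * h1 + (σ ^ 2 * sn σ x : ℂ) * hA - (Real.cos (σ * x) : ℂ) * hB

/-! ### Eigenspaces of the quantum graph Laplacian -/

theorem mem_eigenspace_iff {n : ℕ} [NeZero n] {α ℓ : Fin n → ℝ} {z : ℂ} {u : GraphL2 ℓ} :
    u ∈ eigenspace (graphLaplacian α ℓ) z ↔ LaplacianRel α ℓ u (z • u) := by
  simp only [eigenspace, graphLaplacian_graph]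
  rfl

theorem exists_rep_of_mem_eigenspace {n : ℕ} [NeZero n] {α ℓ : Fin n → ℝ} {z : ℂ}
    {u : GraphL2 ℓ} (hu : u ∈ eigenspace (graphLaplacian α ℓ) z) :
    ∃ f f' : Fin n → ℝ → ℂ,
      (∀ j, IsH1 (ℓ j) (f j) (f' j) ∧ IsH1 (ℓ j) (f' j) fun x => -(z * f j x)) ∧
      Matching α ℓ f f' ∧
      ∀ j, (u j : ℝ → ℂ) =ᵐ[volume.restrict (Set.Ioo 0 (ℓ j))] f j := by
  obtain ⟨f, f', f'', h, hm, hf⟩ := mem_eigenspace_iff.1 hu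
  refine ⟨f, f', fun j => ⟨(h j).1, (h j).2.congr_deriv ?_⟩, hm, fun j => (hf j).1⟩
  filter_upwards [Lp.coeFn_smul z (u j), (hf j).1, (hf j).2] with x h1 h2 h3
  have h4 : ((z • u) j : ℝ → ℂ) x = z * u j x := h1
  rw [h4, h2] at h3
  rw [h3, neg_neg]

/-- Initial data on the edges of the eigenfunctions to the eigenvalue `σ²`. -/
def coefSpace {n : ℕ} [NeZero n] (α ℓ : Fin n → ℝ) (σ : ℝ) :
    Submodule ℂ (Fin n → Fin 2 → ℂ) where
  carrier := {v | Matching α ℓ (fun j => sol σ (v j)) fun j => sol' σ (v j)}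
  zero_mem' := fun j => by simp [sol, sol']
  add_mem' := fun {v w} hv hw j => by
    have hv := hv j
    have hw := hw j
    simp only [sol, sol', Pi.add_apply] at *
    exact ⟨by linear_combination hv.1 + hw.1, by linear_combination hv.2 + hw.2⟩
  smul_mem' := fun c v hv j => by
    have hv := hv j
    simp only [sol, sol', Pi.smul_apply, smul_eq_mul] at *
    exact ⟨by linear_combination c * hv.1, by linear_combination c * hv.2⟩

theorem memLp_sol (σ : ℝ) (v : Fin 2 → ℂ) (L : ℝ) :
    MemLp (sol σ v) 2 (volume.restrict (Set.Ioo 0 L)) :=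
  memLp_Ioo_of_continuous (continuous_sol σ v) L

/-- The function on the graph with given initial data on the edges, as an element of `L²`. -/
def solL2 {n : ℕ} (ℓ : Fin n → ℝ) (σ : ℝ) : (Fin n → Fin 2 → ℂ) →ₗ[ℂ] GraphL2 ℓ where
  toFun v := WithLp.toLp 2 fun j => (memLp_sol σ (v j) (ℓ j)).toLp
  map_add' v w := by
    ext1 j
    have h := MemLp.toLp_add (memLp_sol σ (v j) (ℓ j)) (memLp_sol σ (w j) (ℓ j))
    refine Eq.trans (MemLp.toLp_congr (memLp_sol σ (v j + w j) (ℓ j)) _ ?_) h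
    exact ae_of_all _ fun x => by simp only [sol, Pi.add_apply]; ring
  map_smul' c v := by
    ext1 j
    have h := MemLp.toLp_const_smul c (memLp_sol σ (v j) (ℓ j))
    refine Eq.trans (MemLp.toLp_congr (memLp_sol σ (c • v j) (ℓ j)) _ ?_) h
    exact ae_of_all _ fun x => by simp only [sol, Pi.smul_apply, smul_eq_mul]; ring

theorem coeFn_solL2 {n : ℕ} (ℓ : Fin n → ℝ) (σ : ℝ) (v : Fin n → Fin 2 → ℂ) (j : Fin n) :
    (solL2 ℓ σ v j : ℝ → ℂ) =ᵐ[volume.restrict (Set.Ioo 0 (ℓ j))] sol σ (v j) :=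
  MemLp.coeFn_toLp (memLp_sol σ (v j) (ℓ j))

/-- A continuous function that vanishes almost everywhere on an open edge vanishes there
identically, and so does its derivative; continuity carries both to the end 0, where they are the
initial data. -/
theorem solL2_injective {n : ℕ} {ℓ : Fin n → ℝ} (hℓ : ∀ j, 0 < ℓ j) (σ : ℝ) :
    Function.Injective (solL2 ℓ σ) := by
  rw [← LinearMap.ker_eq_bot, LinearMap.ker_eq_bot']
  intro v hv
  have key : ∀ j, (∀ x ∈ Set.Ioo 0 (ℓ j), sol σ (v j) x = 0) := by
    intro j
    have h1 : sol σ (v j) =ᵐ[volume.restrict (Set.Ioo 0 (ℓ j))] 0 := by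
      refine (coeFn_solL2 ℓ σ v j).symm.trans ?_
      rw [hv]
      exact Lp.coeFn_zero _ _ _
    exact Measure.eqOn_open_of_ae_eq h1 isOpen_Ioo (continuous_sol σ (v j)).continuousOn
      continuousOn_const
  have key' : ∀ j, ∀ x ∈ Set.Ioo 0 (ℓ j), sol' σ (v j) x = 0 := fun j x hx =>
    (hasDerivAt_sol σ (v j) x).unique ((hasDerivAt_const x (0 : ℂ)).congr_of_eventuallyEq (by
      filter_upwards [isOpen_Ioo.mem_nhds hx] with y hy using key j y hy))
  have ext0 : ∀ (g : ℝ → ℂ) (L : ℝ), 0 < L → Continuous g → (∀ x ∈ Set.Ioo 0 L, g x = 0) →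
      g 0 = 0 := by
    intro g L hL hg h
    have h0 : (0 : ℝ) ∈ closure (Set.Ioo 0 L) := by
      rw [closure_Ioo hL.ne]; exact Set.left_mem_Icc.2 hL.le
    exact closure_minimal (s := Set.Ioo 0 L) (t := g ⁻¹' {0}) h
      (isClosed_singleton.preimage hg) h0
  ext j i
  fin_cases i
  · simpa [sol_zero_right] using ext0 _ _ (hℓ j) (continuous_sol σ (v j)) (key j)
  · simpa [sol'_zero_right] using ext0 _ _ (hℓ j) (continuous_sol' σ (v j)) (key' j)

theorem eigenspace_eq_map {n : ℕ} [NeZero n] {α ℓ : Fin n → ℝ} (hℓ : ∀ j, 0 < ℓ j) (σ : ℝ) :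
    eigenspace (graphLaplacian α ℓ) ((σ : ℂ) ^ 2) = (coefSpace α ℓ σ).map (solL2 ℓ σ) := by
  ext u
  constructor
  · intro hu
    obtain ⟨f, f', h, hm, hf⟩ := exists_rep_of_mem_eigenspace hu
    have e : ∀ j, ∀ x ∈ Set.Icc 0 (ℓ j), f j x = sol σ ![f j 0, f' j 0] x ∧
        f' j x = sol' σ ![f j 0, f' j 0] x := fun j x hx => eqOn_sol (hℓ j) (h j).1 (h j).2 hx
    refine ⟨fun j => ![f j 0, f' j 0], fun j => ?_, ?_⟩
    · obtain ⟨e1, e2⟩ := e j _ (Set.right_mem_Icc.2 (hℓ j).le)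
      simpa only [sol_zero_right, sol'_zero_right, ← e1, ← e2, cons_val_zero, cons_val_one] using hm j
    · ext j
      filter_upwards [coeFn_solL2 ℓ σ (fun j => ![f j 0, f' j 0]) j, hf j,
        ae_restrict_mem measurableSet_Ioo] with x h1 h2 hx
      rw [h1, h2, (e j x (Set.Ioo_subset_Icc_self hx)).1]
  · rintro ⟨v, hv, rfl⟩
    rw [mem_eigenspace_iff]
    refine ⟨fun j => sol σ (v j), fun j => sol' σ (v j), fun j x => -(σ ^ 2 * sol σ (v j) x),
      fun j => ⟨?_, ?_⟩, hv, fun j => ⟨coeFn_solL2 ℓ σ v j, ?_⟩⟩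
    · exact isH1_of_hasDerivAt (hasDerivAt_sol σ (v j)) (continuous_sol' σ (v j))
    · have := continuous_sol σ (v j)
      exact isH1_of_hasDerivAt (hasDerivAt_sol' σ (v j)) (by fun_prop)
    · filter_upwards [Lp.coeFn_smul ((σ : ℂ) ^ 2) (solL2 ℓ σ v j), coeFn_solL2 ℓ σ v j]
        with x h1 h2
      have h3 : (((σ : ℂ) ^ 2 • solL2 ℓ σ v) j : ℝ → ℂ) x = (σ : ℂ) ^ 2 * solL2 ℓ σ v j x := h1
      rw [h3, h2, neg_neg]

theorem toENat_rank_eigenspace {n : ℕ} [NeZero n] {α ℓ : Fin n → ℝ} (hℓ : ∀ j, 0 < ℓ j)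
    (σ : ℝ) :
    Cardinal.toENat (Module.rank ℂ (eigenspace (graphLaplacian α ℓ) ((σ : ℂ) ^ 2))) =
      Module.finrank ℂ (coefSpace α ℓ σ) := by
  rw [eigenspace_eq_map hℓ,
    ← (Submodule.equivMapOfInjective _ (solL2_injective hℓ σ) (coefSpace α ℓ σ)).rank_eq,
    ← Module.finrank_eq_rank]
  simp

/-! ### Green's formula and reality of the eigenvalues. -/

/-- If s and c are nonzero, value and derivative are multiplied by the reciprocal real numbers c/s
and s/c. If one of them is zero, each side of the vertex has a vanishing value or derivative, and
both products are 0. -/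
theorem mul_star_eq_of_vertex {s c : ℝ} (hsc : s ^ 2 + c ^ 2 = 1) {a a' b b' : ℂ}
    (h1 : s * b = c * a) (h2 : c * b' = s * a') : b' * star b = a' * star a := by
  have h3 := congrArg star h1
  simp only [star_mul', Complex.star_def, Complex.conj_ofReal] at h3 ⊢
  have hsc : (s : ℂ) ^ 2 + (c : ℂ) ^ 2 = 1 := by exact_mod_cast hsc
  rcases eq_or_ne (s : ℂ) 0 with hs | hs
  · have hc : (c : ℂ) ≠ 0 := by rintro hc; simp [hs, hc] at hsc
    simp only [hs, zero_mul, zero_eq_mul, mul_eq_zero, hc, false_or] at h2 h3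
    simp [h2, h3]
  rcases eq_or_ne (c : ℂ) 0 with hc | hc
  · simp only [hc, zero_mul, zero_eq_mul, mul_eq_zero, hs, false_or] at h2 h3
    simp [h2, h3]
  · refine mul_left_cancel₀ (mul_ne_zero hs hc) ?_
    linear_combination ((s : ℂ) * (starRingEnd ℂ) b) * h2 + ((s : ℂ) * a') * h3

/-- At every vertex the boundary terms of the integration by parts cancel. -/
theorem mul_star_eq_of_matching {n : ℕ} [NeZero n] {α ℓ : Fin n → ℝ} {f f' : Fin n → ℝ → ℂ}
    (h : Matching α ℓ f f') (j : Fin n) :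
    f' (j + 1) 0 * star (f (j + 1) 0) = f' j (ℓ j) * star (f j (ℓ j)) :=
  mul_star_eq_of_vertex (Real.sin_sq_add_cos_sq _) (h j).1 (h j).2

/-- The Green formula for eigenfunctions. -/
theorem energy_identity {n : ℕ} [NeZero n] {α ℓ : Fin n → ℝ} (hℓ : ∀ j, 0 < ℓ j) {z : ℂ}
    {f f' : Fin n → ℝ → ℂ}
    (h : ∀ j, IsH1 (ℓ j) (f j) (f' j) ∧ IsH1 (ℓ j) (f' j) fun x => -(z * f j x))
    (hm : Matching α ℓ f f') :
    ((∑ j, ∫ x in (0 : ℝ)..ℓ j, ‖f' j x‖ ^ 2 : ℝ) : ℂ) =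
      z * ((∑ j, ∫ x in (0 : ℝ)..ℓ j, ‖f j x‖ ^ 2 : ℝ) : ℂ) := by
  -- The derivative of f' f̄ is |f'|² - z |f|², because f'' = -z f.
  have edge : ∀ j, ((∫ x in (0 : ℝ)..ℓ j, ‖f' j x‖ ^ 2 : ℝ) : ℂ) -
      z * ((∫ x in (0 : ℝ)..ℓ j, ‖f j x‖ ^ 2 : ℝ) : ℂ) =
      f' j (ℓ j) * star (f j (ℓ j)) - f' j 0 * star (f j 0) := by
    intro j
    have cf := (h j).1.continuousOn (hℓ j)
    have cg := (h j).2.continuousOn (hℓ j)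
    have i1 : IntervalIntegrable (fun x => ((‖f' j x‖ ^ 2 : ℝ) : ℂ)) volume 0 (ℓ j) := by
      apply ContinuousOn.intervalIntegrable
      rw [Set.uIcc_of_le (hℓ j).le]; fun_prop
    have i2 : IntervalIntegrable (fun x => z * ((‖f j x‖ ^ 2 : ℝ) : ℂ)) volume 0 (ℓ j) := by
      apply ContinuousOn.intervalIntegrable
      rw [Set.uIcc_of_le (hℓ j).le]; fun_prop
    have := intervalIntegral.integral_eq_sub_of_hasDerivAt_of_le (hℓ j).le
      (cg.mul (continuous_star.comp_continuousOn cf)) (fun y hy =>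
        ((h j).2.hasDerivAt (by fun_prop) hy).mul ((h j).1.hasDerivAt cg hy).star)
      ((i1.sub i2).congr (fun y _ => by
        simp only [Complex.ofReal_pow, ← Complex.mul_conj', Complex.star_def, Function.comp]
        ring))
    simp only [Pi.mul_apply, Function.comp] at this
    rw [← this, ← intervalIntegral.integral_ofReal, ← intervalIntegral.integral_ofReal,
      ← intervalIntegral.integral_const_mul, ← intervalIntegral.integral_sub i1 i2]
    refine intervalIntegral.integral_congr fun y _ => ?_
    simp only [Complex.ofReal_pow, ← Complex.mul_conj', Complex.star_def]
    ring
  have hs : ∑ j, f' (j + 1) 0 * star (f (j + 1) 0) = ∑ j, f' j 0 * star (f j 0) :=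
    Equiv.sum_comp (Equiv.addRight (1 : Fin n)) fun j => f' j 0 * star (f j 0)
  rw [← sub_eq_zero]
  push_cast
  rw [Finset.mul_sum, ← Finset.sum_sub_distrib]
  rw [Finset.sum_congr rfl fun j _ => by rw [edge j, ← mul_star_eq_of_matching hm j],
    Finset.sum_sub_distrib, hs, sub_self]

/-- The eigenvalues are real and nonnegative. -/
theorem eigenspace_eq_bot {n : ℕ} [NeZero n] {α ℓ : Fin n → ℝ} (hℓ : ∀ j, 0 < ℓ j) {z : ℂ}
    (hz : ∀ σ : ℝ, 0 ≤ σ → z ≠ (σ : ℂ) ^ 2) : eigenspace (graphLaplacian α ℓ) z = ⊥ := by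
  rw [Submodule.eq_bot_iff]
  intro u hu
  obtain ⟨f, f', h, hm, hf⟩ := exists_rep_of_mem_eigenspace hu
  have key := energy_identity hℓ h hm
  have nn : ∀ g : Fin n → ℝ → ℂ, ∀ j, 0 ≤ ∫ x in (0 : ℝ)..ℓ j, ‖g j x‖ ^ 2 := fun g j =>
    intervalIntegral.integral_nonneg (hℓ j).le fun x _ => by positivity
  set F := ∑ j, ∫ x in (0 : ℝ)..ℓ j, ‖f j x‖ ^ 2 with hF
  set G := ∑ j, ∫ x in (0 : ℝ)..ℓ j, ‖f' j x‖ ^ 2 with hG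
  have F0 : 0 ≤ F := Finset.sum_nonneg fun j _ => nn f j
  have G0 : 0 ≤ G := Finset.sum_nonneg fun j _ => nn f' j
  have hFz : F = 0 := by
    by_contra hne
    -- If F ≠ 0, the energy identity says that z is the Rayleigh quotient G / F ≥ 0, hence a real
    -- square.
    refine hz (Real.sqrt (G / F)) (Real.sqrt_nonneg _) ?_
    rw [← Complex.ofReal_pow, Real.sq_sqrt (by positivity), Complex.ofReal_div, key]
    rw [mul_div_cancel_right₀]
    exact_mod_cast hne
  have hj := (Finset.sum_eq_zero_iff_of_nonneg fun j _ => nn f j).1 hFz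
  ext j
  have cf := (h j).1.continuousOn (hℓ j)
  have hzero : ∀ x ∈ Set.Ioc 0 (ℓ j), f j x = 0 := by
    intro x hx
    by_contra hne
    have := intervalIntegral.integral_pos (hℓ j) (f := fun x => ‖f j x‖ ^ 2) (by fun_prop)
      (fun x _ => by positivity) ⟨x, Set.Ioc_subset_Icc_self hx, by positivity⟩
    exact this.ne' (hj j (Finset.mem_univ j))
  filter_upwards [hf j, ae_restrict_mem measurableSet_Ioo,
    Lp.coeFn_zero ℂ 2 (volume.restrict (Set.Ioo 0 (ℓ j)))] with x h1 hx h2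
  rw [h1, hzero x (Set.Ioo_subset_Ioc_self hx)]
  exact h2.symm

/-! ### Linear systems on the cyclic graph -/

section Cyclic

variable {n : ℕ} [NeZero n]

theorem ofNat_add (a b : ℕ) : Fin.ofNat n (a + b) = Fin.ofNat n a + Fin.ofNat n b := by
  ext; simp [Fin.val_add]

theorem ofNat_one : Fin.ofNat n 1 = 1 := rfl

theorem ofNat_self : Fin.ofNat n n = 0 := by ext; simp

theorem ofNat_val (j : Fin n) : Fin.ofNat n j = j := by
  ext; simp

/-- The composition of the first `k` of the maps `G 0, G 1, …`, with cyclic indices. -/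
def monodromy {V : Type*} [AddCommGroup V] [Module ℂ V] (G : Fin n → V →ₗ[ℂ] V) :
    ℕ → V →ₗ[ℂ] V
  | 0 => LinearMap.id
  | k + 1 => G (Fin.ofNat n k) ∘ₗ monodromy G k

/-- The solutions of `v (j + 1) = G j (v j)` on the cycle. -/
def cycSpace {V : Type*} [AddCommGroup V] [Module ℂ V] (G : Fin n → V →ₗ[ℂ] V) :
    Submodule ℂ (Fin n → V) where
  carrier := {v | ∀ j, v (j + 1) = G j (v j)}
  zero_mem' := fun j => by simp
  add_mem' := fun hv hw j => by simp [hv j, hw j]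
  smul_mem' := fun c v hv j => by simp [hv j]

theorem cycSpace_apply {V : Type*} [AddCommGroup V] [Module ℂ V] {G : Fin n → V →ₗ[ℂ] V}
    {v : Fin n → V} (hv : v ∈ cycSpace G) (k : ℕ) :
    v (Fin.ofNat n k) = monodromy G k (v 0) := by
  induction k with
  | zero => rfl
  | succ k ih => rw [ofNat_add, ofNat_one, hv, ih]; rfl

/-- A solution on the cycle is determined by its value at 0, and one full turn must reproduce that
value; conversely, a fixed vector of the full turn unrolls to a solution. -/
theorem finrank_cycSpace {V : Type*} [AddCommGroup V] [Module ℂ V] (G : Fin n → V →ₗ[ℂ] V) :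
    Module.finrank ℂ (cycSpace G) =
      Module.finrank ℂ (Module.End.eigenspace (monodromy G n) 1) := by
  let Φ : V →ₗ[ℂ] Fin n → V := LinearMap.pi fun j => monodromy G j
  have hΦ : Function.Injective Φ := fun v w h => congrFun h 0
  have hmap : cycSpace G = (Module.End.eigenspace (monodromy G n) 1).map Φ := by
    ext v
    constructor
    · intro hv
      refine ⟨v 0, ?_, ?_⟩
      · rw [SetLike.mem_coe, Module.End.mem_eigenspace_iff, ← cycSpace_apply hv, one_smul,
          ofNat_self]
      · ext1 j
        exact (cycSpace_apply hv j).symm.trans (congrArg v (ofNat_val j))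
    · rintro ⟨w, hw, rfl⟩ j
      rw [SetLike.mem_coe, Module.End.mem_eigenspace_iff, one_smul] at hw
      change monodromy G (j + 1 : Fin n) w = G j (monodromy G j w)
      have h1 : G j (monodromy G j w) = monodromy G (j + 1 : ℕ) w := by
        rw [monodromy, ofNat_val]; rfl
      rw [h1]
      rcases Nat.lt_or_ge (j + 1 : ℕ) n with h | h
      · rw [Fin.val_add_one_of_lt' h]
      -- Closing the cycle is the only place where the fixed-vector property is needed.
      · have h2 : (j + 1 : ℕ) = n := le_antisymm j.isLt h
        have h3 : j + 1 = 0 := by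
          rw [← ofNat_val j, ← ofNat_one, ← ofNat_add, h2, ofNat_self]
        rw [h3, h2, hw]; rfl
  rw [hmap]
  exact (Submodule.equivMapOfInjective Φ hΦ _).finrank_eq.symm

theorem reverse_prod_ofFn {M : Type*} [Monoid M] {V : Type*} [AddCommGroup V] [Module ℂ V]
    (φ : M →* Module.End ℂ V) (A : Fin n → M) :
    φ (List.ofFn A).reverse.prod = monodromy (fun j => φ (A j)) n := by
  -- The induction is on the number of factors with n kept fixed, so the indices are read
  -- cyclically.
  have key : ∀ k, φ (List.ofFn fun j : Fin k => A (Fin.ofNat n j)).reverse.prod =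
      monodromy (fun j => φ (A j)) k := by
    intro k
    induction k with
    | zero => simp [monodromy]; rfl
    | succ k ih =>
      rw [List.ofFn_succ', List.concat_eq_append, List.reverse_append, List.prod_append, map_mul]
      simp only [Fin.val_castSucc, ih]
      simp [monodromy]; rfl
  rw [← key]
  simp only [ofNat_val]

/-! ### Combinatorics of exceptional components. -/

theorem step_zero (s : Fin n) : step s 0 = s := by
  change s + 0 = s
  exact add_zero s

theorem step_succ (s : Fin n) (m : ℕ) : step s (m + 1) = step s m + 1 := by
  rw [step, step, ofNat_add, ofNat_one, add_assoc]

theorem step_sub_ofNat (j : Fin n) (m : ℕ) : step (j - Fin.ofNat n m) m = j :=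
  sub_add_cancel _ _

variable (α : Fin n → ℝ)

/-- The number of steps back from the side `j` to the exceptional vertex at which its exceptional
component starts. -/
def prevDist (j : Fin n) : ℕ :=
  sInf {m : ℕ | 1 ≤ m ∧ IsExceptional (α (j - Fin.ofNat n m))}

/-- The exceptional vertex at which the exceptional component of the side `j` starts. -/
def prevExceptional (j : Fin n) : Fin n := j - Fin.ofNat n (prevDist α j)

variable {α}

theorem prevDist_spec (hex : ∃ j, IsExceptional (α j)) (j : Fin n) :
    1 ≤ prevDist α j ∧ IsExceptional (α (prevExceptional α j)) := by
  obtain ⟨e, he⟩ := hex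
  refine Nat.sInf_mem (s := {m : ℕ | 1 ≤ m ∧ IsExceptional (α (j - Fin.ofNat n m))})
    -- The extra full turn n makes the number of steps positive even if j = e.
    ⟨(j - e : Fin n) + n, ?_, ?_⟩
  · have := NeZero.pos n; omega
  · rw [ofNat_add, ofNat_self, ofNat_val, add_zero, sub_sub_cancel]; exact he

theorem prevDist_le {j : Fin n} {m : ℕ} (hm : 1 ≤ m)
    (h : IsExceptional (α (j - Fin.ofNat n m))) : prevDist α j ≤ m :=
  Nat.sInf_le ⟨hm, h⟩

theorem step_prevExceptional (j : Fin n) : step (prevExceptional α j) (prevDist α j) = j :=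
  step_sub_ofNat _ _

theorem compSize_spec {s : Fin n} (hs : IsExceptional (α s)) :
    1 ≤ compSize α s ∧ IsExceptional (α (nextExceptional α s)) :=
  Nat.sInf_mem (s := {m : ℕ | 1 ≤ m ∧ IsExceptional (α (step s m))})
    ⟨n, NeZero.pos n, by rwa [step, ofNat_self, add_zero]⟩

theorem compSize_le {s : Fin n} {m : ℕ} (hm : 1 ≤ m) (h : IsExceptional (α (step s m))) :
    compSize α s ≤ m :=
  Nat.sInf_le ⟨hm, h⟩

theorem prevDist_succ_of_exceptional {j : Fin n} (hj : IsExceptional (α j)) :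
    prevDist α (j + 1) = 1 := by
  refine le_antisymm (prevDist_le le_rfl ?_) (prevDist_spec ⟨j, hj⟩ _).1
  rwa [ofNat_one, add_sub_cancel_right]

theorem prevExceptional_succ_of_exceptional {j : Fin n} (hj : IsExceptional (α j)) :
    prevExceptional α (j + 1) = j := by
  rw [prevExceptional, prevDist_succ_of_exceptional hj, ofNat_one, add_sub_cancel_right]

theorem prevDist_succ_of_not (hex : ∃ j, IsExceptional (α j)) {j : Fin n}
    (hj : ¬IsExceptional (α j)) : prevDist α (j + 1) = prevDist α j + 1 := by
  have shift : ∀ m, j + 1 - Fin.ofNat n (m + 1) = j - Fin.ofNat n m := fun m => by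
    rw [ofNat_add, ofNat_one]; abel
  apply le_antisymm
  · refine prevDist_le (by omega) ?_
    rw [shift]; exact (prevDist_spec hex j).2
  · obtain ⟨h1, h2⟩ := prevDist_spec hex (j + 1)
    rw [prevExceptional] at h2
    obtain ⟨m, hm⟩ := Nat.exists_eq_add_of_le' h1
    rw [hm, shift] at h2
    rw [hm]
    rcases Nat.eq_zero_or_pos m with rfl | hpos
    · exact absurd (by simpa using h2) hj
    · exact Nat.succ_le_succ (prevDist_le hpos h2)

theorem prevExceptional_succ_of_not (hex : ∃ j, IsExceptional (α j)) {j : Fin n}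
    (hj : ¬IsExceptional (α j)) : prevExceptional α (j + 1) = prevExceptional α j := by
  rw [prevExceptional, prevDist_succ_of_not hex hj, ofNat_add, ofNat_one, prevExceptional]
  abel

/-- Forward and backward distances agree: an exceptional vertex met earlier on the way forward would
also be met earlier on the way back. With the symmetric statement `prevDist_nextExceptional`, this
makes `nextExceptional` a bijection of the exceptional vertices. -/
theorem compSize_prevExceptional {j : Fin n} (hj : IsExceptional (α j)) :
    compSize α (prevExceptional α j) = prevDist α j := by
  have hp := prevDist_spec ⟨j, hj⟩ j
  apply le_antisymm
  · exact compSize_le hp.1 (by rwa [step_prevExceptional])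
  · by_contra! h
    obtain ⟨h1, h2⟩ := compSize_spec hp.2
    set m := compSize α (prevExceptional α j)
    have := prevDist_le (α := α) (j := j) (m := prevDist α j - m) (by omega) (by
      convert h2 using 2
      change _ = prevExceptional α j + Fin.ofNat n m
      have e : prevExceptional α j = j - Fin.ofNat n (prevDist α j) := rfl
      have : Fin.ofNat n (prevDist α j) = Fin.ofNat n (prevDist α j - m) + Fin.ofNat n m := by
        rw [← ofNat_add]; congr 1; omega
      rw [e, this]; abel)
    omega

theorem nextExceptional_prevExceptional {j : Fin n} (hj : IsExceptional (α j)) :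
    nextExceptional α (prevExceptional α j) = j := by
  rw [nextExceptional, compSize_prevExceptional hj, step_prevExceptional]

theorem prevDist_nextExceptional {s : Fin n} (hs : IsExceptional (α s)) :
    prevDist α (nextExceptional α s) = compSize α s := by
  obtain ⟨h1, h2⟩ := compSize_spec hs
  apply le_antisymm
  · exact prevDist_le h1 (by rwa [nextExceptional, step, add_sub_cancel_right])
  · by_contra! h
    obtain ⟨h3, h4⟩ := prevDist_spec ⟨s, hs⟩ (nextExceptional α s)
    rw [prevExceptional] at h4
    set d := prevDist α (nextExceptional α s)
    have := compSize_le (α := α) (s := s) (m := compSize α s - d) (by omega) (by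
      convert h4 using 2
      rw [nextExceptional, step, step]
      have : Fin.ofNat n (compSize α s) = Fin.ofNat n (compSize α s - d) + Fin.ofNat n d := by
        rw [← ofNat_add]; congr 1; omega
      rw [this]; abel)
    omega

theorem prevExceptional_nextExceptional {s : Fin n} (hs : IsExceptional (α s)) :
    prevExceptional α (nextExceptional α s) = s := by
  rw [prevExceptional, prevDist_nextExceptional hs, nextExceptional, step, add_sub_cancel_right]

/-! ### Linear systems cut into components at the exceptional vertices. -/

section Boundary

variable {V : Type*} [AddCommGroup V] [Module ℂ V]

/-- The vector `x s` transported from the exceptional vertex `s` through the `m` sides and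
vertices that follow. -/
def pathVec (G : Fin n → V →ₗ[ℂ] V) (x : Fin n → V) (s : Fin n) : ℕ → V
  | 0 => x s
  | m + 1 => G (step s (m + 1)) (pathVec G x s m)

theorem pathVec_eq_zero {G : Fin n → V →ₗ[ℂ] V} {x : Fin n → V} {s : Fin n} (h : x s = 0)
    (m : ℕ) : pathVec G x s m = 0 := by
  induction m with
  | zero => exact h
  | succ m ih => rw [pathVec, ih, map_zero]

variable (α)

/-- The solutions of `v (j + 1) = G j (v j)` at the non-exceptional vertices, with the boundary
conditions `v (j + 1) ∈ ℂ x j` and `e j (v j) = 0` at the exceptional ones. -/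
def boundarySpace (G : Fin n → V →ₗ[ℂ] V) (x : Fin n → V) (e : Fin n → V →ₗ[ℂ] ℂ) :
    Submodule ℂ (Fin n → V) where
  carrier := {v | ∀ j, (¬IsExceptional (α j) → v (j + 1) = G j (v j)) ∧
    (IsExceptional (α j) → v (j + 1) ∈ Submodule.span ℂ {x j} ∧ e j (v j) = 0)}
  zero_mem' := fun j => by simp
  add_mem' := fun hv hw j => ⟨fun h => by simp [(hv j).1 h, (hw j).1 h], fun h =>
    ⟨add_mem ((hv j).2 h).1 ((hw j).2 h).1, by simp [((hv j).2 h).2, ((hw j).2 h).2]⟩⟩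
  smul_mem' := fun c v hv j => ⟨fun h => by simp [(hv j).1 h], fun h =>
    ⟨Submodule.smul_mem _ c ((hv j).2 h).1, by simp [((hv j).2 h).2]⟩⟩

open Classical in
/-- The dimension of the solution space is the number of components with a nonzero solution. -/
theorem finrank_boundarySpace (hex : ∃ j, IsExceptional (α j)) (G : Fin n → V →ₗ[ℂ] V)
    (x : Fin n → V) (e : Fin n → V →ₗ[ℂ] ℂ) :
    Module.finrank ℂ (boundarySpace α G x e) =
      {s | IsExceptional (α s) ∧ x s ≠ 0 ∧
        e (nextExceptional α s) (pathVec G x s (compSize α s - 1)) = 0}.ncard := by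
  set S := {s | IsExceptional (α s) ∧ x s ≠ 0 ∧
        e (nextExceptional α s) (pathVec G x s (compSize α s - 1)) = 0} with hS
  -- Each admissible component gets one free scalar, multiplying its transported start vector; the
  -- other components get zero. The vector on the side j has passed `prevDist α j - 1` vertices, one
  -- fewer than the number of sides.
  let Ψ : (S → ℂ) →ₗ[ℂ] Fin n → V :=
    { toFun := fun c j => (if h : prevExceptional α j ∈ S then c ⟨_, h⟩ else 0) •
        pathVec G x (prevExceptional α j) (prevDist α j - 1)
      map_add' := fun c d => by
        ext1 j
        by_cases h : prevExceptional α j ∈ S <;> simp [h, add_smul]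
      map_smul' := fun a c => by
        ext1 j
        by_cases h : prevExceptional α j ∈ S <;> simp [h, mul_smul] }
  have hΨ : ∀ c j, Ψ c j = (if h : prevExceptional α j ∈ S then c ⟨_, h⟩ else 0) •
        pathVec G x (prevExceptional α j) (prevDist α j - 1) := fun _ _ => rfl
  have inj : Function.Injective Ψ := by
    rw [← LinearMap.ker_eq_bot, LinearMap.ker_eq_bot']
    intro c hc
    ext ⟨s, hs⟩
    have h1 := congrFun hc (s + 1)
    simp only [hΨ, prevExceptional_succ_of_exceptional hs.1, prevDist_succ_of_exceptional hs.1,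
      Nat.sub_self, hs, dite_true] at h1
    exact (smul_eq_zero.1 h1).resolve_right hs.2.1
  have range : LinearMap.range Ψ = boundarySpace α G x e := by
    ext v
    constructor
    · rintro ⟨c, rfl⟩ j
      refine ⟨fun hj => ?_, fun hj => ⟨?_, ?_⟩⟩
      · obtain ⟨m, hm⟩ := Nat.exists_eq_add_of_le' (prevDist_spec hex j).1
        have hstep := step_prevExceptional (α := α) j
        simp only [hΨ, prevExceptional_succ_of_not hex hj, prevDist_succ_of_not hex hj,
          map_smul]
        rw [hm] at hstep ⊢
        simp only [Nat.add_sub_cancel, pathVec, hstep]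
      · rw [hΨ, prevExceptional_succ_of_exceptional hj, prevDist_succ_of_exceptional hj]
        exact Submodule.smul_mem _ _ (Submodule.mem_span_singleton_self _)
      · rw [hΨ, map_smul]
        by_cases h : prevExceptional α j ∈ S
        · have h2 := h.2.2
          rw [nextExceptional_prevExceptional hj, compSize_prevExceptional hj] at h2
          rw [h2, smul_zero]
        · simp [h]
    · intro hv
      have hc : ∀ s, ∃ c : ℂ, IsExceptional (α s) → c • x s = v (s + 1) := by
        intro s
        by_cases hs : IsExceptional (α s)
        · obtain ⟨c, hc⟩ := Submodule.mem_span_singleton.1 ((hv s).2 hs).1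
          exact ⟨c, fun _ => hc⟩
        · exact ⟨0, fun h => absurd h hs⟩
      choose c hc using hc
      -- Within a component any solution is the start vector times the scalar found at its start,
      -- transported.
      have claim : ∀ m j, prevDist α j = m + 1 →
          v j = c (prevExceptional α j) • pathVec G x (prevExceptional α j) m := by
        intro m
        induction m with
        | zero =>
          intro j hj
          have h1 := step_prevExceptional (α := α) j
          rw [hj, step_succ, step_zero] at h1
          rw [pathVec, hc _ (prevDist_spec hex j).2, h1]
        | succ m ih =>
          intro j hj
          obtain ⟨i, rfl⟩ : ∃ i, j = i + 1 := ⟨j - 1, (sub_add_cancel j 1).symm⟩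
          have hi : ¬IsExceptional (α i) := fun h => by
            rw [prevDist_succ_of_exceptional h] at hj; omega
          have hd : prevDist α i = m + 1 := by
            rw [prevDist_succ_of_not hex hi] at hj; omega
          have hstep := step_prevExceptional (α := α) i
          rw [hd] at hstep
          rw [(hv i).1 hi, ih i hd, prevExceptional_succ_of_not hex hi, map_smul, pathVec, hstep]
      refine ⟨fun s => c s, ?_⟩
      ext1 j
      rw [hΨ, claim (prevDist α j - 1) j (by have := (prevDist_spec hex j).1; omega)]
      by_cases h : prevExceptional α j ∈ S
      · simp [h]
      · simp only [h, dite_false, zero_smul]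
        symm
        have hs := (prevDist_spec hex j).2
        set s := prevExceptional α j
        by_cases hx : x s = 0
        · rw [pathVec_eq_zero hx, smul_zero]
        -- On a component outside `S` with nonzero start vector the end functional does not vanish,
        -- so the end condition kills the scalar.
        · have he : e (nextExceptional α s) (pathVec G x s (compSize α s - 1)) ≠ 0 :=
            fun h0 => h ⟨hs, hx, h0⟩
          have h1 := claim (compSize α s - 1) (nextExceptional α s) (by
            rw [prevDist_nextExceptional hs]; have := (compSize_spec hs).1; omega)
          have h2 := ((hv _).2 (compSize_spec hs).2).2
          rw [h1, prevExceptional_nextExceptional hs, map_smul, smul_eq_mul] at h2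
          rw [(mul_eq_zero.1 h2).resolve_right he, zero_smul]
  rw [← range, LinearMap.finrank_range_of_inj inj, Module.finrank_fintype_fun_eq_card,
    ← Nat.card_eq_fintype_card, Nat.card_coe_set_eq]

end Boundary

end Cyclic

/-! ### Angles -/

theorem angleMu_eq (a : ℝ) : angleMu a = 2 * (Real.pi ^ 2 / (4 * a)) := by
  rw [angleMu]; ring

theorem isExceptional_iff {a : ℝ} (ha : 0 < a) : IsExceptional a ↔ Real.sin (angleMu a) = 0 := by
  have hpi := Real.pi_pos
  rw [Real.sin_eq_zero_iff, IsExceptional, angleMu]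
  constructor
  · rintro ⟨k, hk, rfl⟩
    have : (k : ℝ) ≠ 0 := by positivity
    exact ⟨k, by push_cast; field_simp⟩
  · rintro ⟨m, hm⟩
    have hpos : 0 < (m : ℝ) * Real.pi := by rw [hm]; positivity
    have hm0 : 0 < m := by exact_mod_cast pos_of_mul_pos_left hpos hpi.le
    lift m to ℕ using hm0.le
    refine ⟨m, by omega, ?_⟩
    push_cast at hm
    have : (m : ℝ) ≠ 0 := by have : 0 < m := by omega
                             positivity
    field_simp at hm ⊢
    linarith

theorem sin_cos_ne_zero {a : ℝ} (ha : 0 < a) (h : ¬IsExceptional a) :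
    Real.sin (Real.pi ^ 2 / (4 * a)) ≠ 0 ∧ Real.cos (Real.pi ^ 2 / (4 * a)) ≠ 0 := by
  rw [isExceptional_iff ha, angleMu_eq, Real.sin_two_mul] at h
  constructor <;> intro h0 <;> simp [h0] at h

/-- At an exceptional angle the matching conditions decouple. Parity 1 means Dirichlet before the
vertex and Neumann after it; parity -1 means the reverse. -/
theorem exceptional_cases {a : ℝ} (ha : 0 < a) (h : IsExceptional a) :
    (parity a = 1 ∧ Real.sin (Real.pi ^ 2 / (4 * a)) = 0 ∧
      Real.cos (Real.pi ^ 2 / (4 * a)) ≠ 0) ∨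
    (parity a = -1 ∧ Real.cos (Real.pi ^ 2 / (4 * a)) = 0 ∧
      Real.sin (Real.pi ^ 2 / (4 * a)) ≠ 0) := by
  rw [isExceptional_iff ha, angleMu_eq, Real.sin_two_mul] at h
  have h1 := Real.sin_sq_add_cos_sq (Real.pi ^ 2 / (4 * a))
  rw [parity, angleMu_eq, Real.cos_two_mul]
  rcases eq_or_ne (Real.sin (Real.pi ^ 2 / (4 * a))) 0 with hs | hs
  · left
    rw [hs] at h1
    refine ⟨by linarith, hs, fun hc => ?_⟩
    rw [hc] at h1; norm_num at h1
  · right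
    have hc : Real.cos (Real.pi ^ 2 / (4 * a)) = 0 := by simpa [hs] using h
    exact ⟨by rw [hc]; norm_num, hc, hs⟩

/-- `cot (π² / (4a))`, the factor by which function values jump at a vertex. -/
def jump (a : ℝ) : ℝ := Real.cos (Real.pi ^ 2 / (4 * a)) / Real.sin (Real.pi ^ 2 / (4 * a))

theorem jump_ne_zero {a : ℝ} (ha : 0 < a) (h : ¬IsExceptional a) : jump a ≠ 0 :=
  div_ne_zero (sin_cos_ne_zero ha h).2 (sin_cos_ne_zero ha h).1

/-! ### Values and derivatives in terms of the amplitudes -/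

/-- The value of the wave with amplitudes `v 0` and `-i v 1`. -/
def dval : (Fin 2 → ℂ) →ₗ[ℂ] ℂ := LinearMap.proj 0 - Complex.I • LinearMap.proj 1

/-- The normalised derivative of the wave with amplitudes `v 0` and `-i v 1`. -/
def nval : (Fin 2 → ℂ) →ₗ[ℂ] ℂ := LinearMap.proj 0 + Complex.I • LinearMap.proj 1

theorem dval_apply (v : Fin 2 → ℂ) : dval v = v 0 - Complex.I * v 1 := rfl

theorem nval_apply (v : Fin 2 → ℂ) : nval v = v 0 + Complex.I * v 1 := rfl

theorem ext_dval_nval {v w : Fin 2 → ℂ} (hd : dval v = dval w) (hn : nval v = nval w) :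
    v = w := by
  rw [dval_apply, dval_apply] at hd
  rw [nval_apply, nval_apply] at hn
  ext i
  fin_cases i
  · change v 0 = w 0
    linear_combination (hd + hn) / 2
  · change v 1 = w 1
    linear_combination Complex.I / 2 * (hd - hn) + (v 1 - w 1) * Complex.I_sq

/-- `dval` is a left eigenvector of the vertex matrix with eigenvalue csc μ + cot μ, which is
cot(μ/2). For `nval` the eigenvalue is csc μ - cot μ = tan(μ/2). -/
theorem dval_vertexMatrix {a : ℝ} (ha : 0 < a) (h : ¬IsExceptional a) (v : Fin 2 → ℂ) :
    dval (vertexMatrix a *ᵥ v) = jump a * dval v := by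
  obtain ⟨hs, hc⟩ := sin_cos_ne_zero ha h
  have key : 1 / Real.sin (angleMu a) + Real.cos (angleMu a) / Real.sin (angleMu a) =
      jump a := by
    rw [angleMu_eq, Real.sin_two_mul, Real.cos_two_mul, jump]; field_simp; ring
  have key' : ((1 / Real.sin (angleMu a) : ℝ) : ℂ) +
      ((Real.cos (angleMu a) / Real.sin (angleMu a) : ℝ) : ℂ) = jump a := by
    rw [← key]; push_cast; rfl
  rw [← key', dval_apply, dval_apply, vertexMatrix]
  simp only [mulVec, dotProduct, Fin.sum_univ_two, of_apply, cons_val', cons_val_zero,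
    cons_val_one, cons_val_fin_one]
  linear_combination (-(((Real.cos (angleMu a) / Real.sin (angleMu a) : ℝ) : ℂ)) * v 0) *
    Complex.I_sq

theorem nval_vertexMatrix {a : ℝ} (ha : 0 < a) (h : ¬IsExceptional a) (v : Fin 2 → ℂ) :
    nval (vertexMatrix a *ᵥ v) = (jump a : ℂ)⁻¹ * nval v := by
  obtain ⟨hs, hc⟩ := sin_cos_ne_zero ha h
  have key : 1 / Real.sin (angleMu a) - Real.cos (angleMu a) / Real.sin (angleMu a) =
      (jump a)⁻¹ := by
    have h1 := Real.sin_sq_add_cos_sq (Real.pi ^ 2 / (4 * a))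
    rw [angleMu_eq, Real.sin_two_mul, Real.cos_two_mul, jump]; field_simp
    linear_combination (-2) * h1
  have key' : ((1 / Real.sin (angleMu a) : ℝ) : ℂ) -
      ((Real.cos (angleMu a) / Real.sin (angleMu a) : ℝ) : ℂ) = (jump a : ℂ)⁻¹ := by
    rw [← Complex.ofReal_inv, ← key]; push_cast; rfl
  rw [← key', nval_apply, nval_apply, vertexMatrix]
  simp only [mulVec, dotProduct, Fin.sum_univ_two, of_apply, cons_val', cons_val_zero,
    cons_val_one, cons_val_fin_one]
  linear_combination (((Real.cos (angleMu a) / Real.sin (angleMu a) : ℝ) : ℂ) * v 0) *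
    Complex.I_sq

theorem sideMatrix_mulVec (l σ : ℝ) (v : Fin 2 → ℂ) : sideMatrix l σ *ᵥ v =
    ![Complex.exp (Complex.I * l * σ) * v 0, Complex.exp (-(Complex.I * l * σ)) * v 1] := by
  ext i
  fin_cases i <;> simp [sideMatrix, mulVec, dotProduct, Fin.sum_univ_two]

theorem sideMatrix_zero (l : ℝ) : sideMatrix l 0 = 1 := by
  ext i j
  fin_cases i <;> fin_cases j <;> simp [sideMatrix]

/-- The amplitudes of the wave with initial data `p`. -/
def amplitude {σ : ℝ} (hσ : σ ≠ 0) : (Fin 2 → ℂ) ≃ₗ[ℂ] (Fin 2 → ℂ) where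
  toFun p := ![(p 0 + p 1 / (Complex.I * σ)) / 2, Complex.I * (p 0 - p 1 / (Complex.I * σ)) / 2]
  invFun v := ![dval v, Complex.I * σ * nval v]
  map_add' p q := by ext i; fin_cases i <;> simp <;> ring
  map_smul' c p := by ext i; fin_cases i <;> simp <;> ring
  left_inv p := by
    have : (σ : ℂ) ≠ 0 := by exact_mod_cast hσ
    ext i
    fin_cases i
    · simp [dval_apply]
      linear_combination (-(p 0 - p 1 / (Complex.I * σ)) / 2) * Complex.I_sq
    · simp [nval_apply]
      field_simp
      linear_combination (p 0 * Complex.I * σ - p 1) * Complex.I_sq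
  right_inv v := by
    have : (σ : ℂ) ≠ 0 := by exact_mod_cast hσ
    ext i
    fin_cases i
    · simp [dval_apply, nval_apply]
      field_simp; ring
    · simp [dval_apply, nval_apply]
      field_simp
      linear_combination (-2 * v 1) * Complex.I_sq

theorem dval_amplitude {σ : ℝ} (hσ : σ ≠ 0) (p : Fin 2 → ℂ) : dval (amplitude hσ p) = p 0 :=
  congrFun ((amplitude hσ).left_inv p) 0

theorem nval_amplitude {σ : ℝ} (hσ : σ ≠ 0) (p : Fin 2 → ℂ) :
    Complex.I * σ * nval (amplitude hσ p) = p 1 :=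
  congrFun ((amplitude hσ).left_inv p) 1

/-- The two travelling waves do not interact on a side, so propagation is diagonal in the
amplitudes; the computation is Euler's formula. -/
theorem sideMatrix_amplitude {σ : ℝ} (hσ : σ ≠ 0) (l : ℝ) (p : Fin 2 → ℂ) :
    sideMatrix l σ *ᵥ amplitude hσ p = amplitude hσ ![sol σ p l, sol' σ p l] := by
  have hσ' : (σ : ℂ) ≠ 0 := by exact_mod_cast hσ
  have e1 : Complex.exp (Complex.I * l * σ) =
      Complex.cos (σ * l) + Complex.sin (σ * l) * Complex.I := by
    rw [← Complex.exp_mul_I]; congr 1; ring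
  have e2 : Complex.exp (-(Complex.I * l * σ)) =
      Complex.cos (σ * l) - Complex.sin (σ * l) * Complex.I := by
    have := Complex.exp_mul_I (-(σ * l : ℂ))
    rw [Complex.cos_neg, Complex.sin_neg, neg_mul (Complex.sin _), ← sub_eq_add_neg] at this
    rw [← this]; congr 1; ring
  rw [sideMatrix_mulVec, e1, e2]
  ext i
  fin_cases i
  · simp [amplitude, sol, sol', sn, hσ]
    field_simp
    linear_combination (σ * p 0 * Complex.sin (σ * l)) * Complex.I_sq
  · simp [amplitude, sol, sol', sn, hσ]
    field_simp
    linear_combination (-(σ * p 0 * Complex.sin (σ * l))) * Complex.I_sq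

theorem dval_sideMatrix {σ : ℝ} (hσ : σ ≠ 0) (l : ℝ) (p : Fin 2 → ℂ) :
    dval (sideMatrix l σ *ᵥ amplitude hσ p) = sol σ p l := by
  rw [sideMatrix_amplitude, dval_amplitude]; rfl

theorem nval_sideMatrix {σ : ℝ} (hσ : σ ≠ 0) (l : ℝ) (p : Fin 2 → ℂ) :
    Complex.I * σ * nval (sideMatrix l σ *ᵥ amplitude hσ p) = sol' σ p l := by
  rw [sideMatrix_amplitude, nval_amplitude]; rfl

/-- Lets the phase e^{-iπ/4} be pulled out of both boundary vectors, which leaves (1, i) and (i, 1).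
-/
theorem exp_pi_div_four :
    Complex.exp (Complex.I * Real.pi / 4) = Complex.I * Complex.exp (-(Complex.I * Real.pi / 4)) := by
  have h : Complex.exp (Real.pi / 2 * Complex.I) = Complex.I := Complex.exp_pi_div_two_mul_I
  rw [← h, ← Complex.exp_add]
  congr 1
  rw [h]; ring

/-- The common scalar factor of `xEven` and `xOdd`. -/
def xScalar : ℂ := 1 / (Real.sqrt 2 : ℂ) * Complex.exp (-(Complex.I * Real.pi / 4))

theorem xScalar_ne_zero : xScalar ≠ 0 := by
  refine mul_ne_zero (one_div_ne_zero ?_) (Complex.exp_ne_zero _)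
  exact_mod_cast (Real.sqrt_pos.2 two_pos).ne'

theorem xEven_eq : xEven = xScalar • ![1, Complex.I] := by
  rw [xEven, xScalar, exp_pi_div_four]
  ext i
  fin_cases i
  · simp
  · simp; ring

theorem xOdd_eq : xOdd = xScalar • ![Complex.I, 1] := by
  rw [xOdd, xScalar, exp_pi_div_four]
  ext i
  fin_cases i
  · simp; ring
  · simp

theorem mem_span_xEven {v : Fin 2 → ℂ} : v ∈ Submodule.span ℂ {xEven} ↔ nval v = 0 := by
  rw [Submodule.mem_span_singleton]
  constructor
  · rintro ⟨c, rfl⟩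
    simp only [xEven_eq, nval_apply, Pi.smul_apply, smul_eq_mul, cons_val_zero, cons_val_one]
    linear_combination (c * xScalar) * Complex.I_sq
  · intro h
    refine ⟨v 0 / xScalar, ?_⟩
    rw [xEven_eq, smul_smul, div_mul_cancel₀ _ xScalar_ne_zero]
    rw [nval_apply] at h
    ext i
    fin_cases i
    · simp
    · simp; linear_combination Complex.I * h - v 1 * Complex.I_sq

theorem mem_span_xOdd {v : Fin 2 → ℂ} : v ∈ Submodule.span ℂ {xOdd} ↔ dval v = 0 := by
  rw [Submodule.mem_span_singleton]
  constructor
  · rintro ⟨c, rfl⟩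
    simp only [xOdd_eq, dval_apply, Pi.smul_apply, smul_eq_mul, cons_val_zero, cons_val_one]
    ring
  · intro h
    refine ⟨v 1 / xScalar, ?_⟩
    rw [xOdd_eq, smul_smul, div_mul_cancel₀ _ xScalar_ne_zero]
    rw [dval_apply] at h
    ext i
    fin_cases i
    · simp; linear_combination -h
    · simp

/-- Conjugation turns (1, i) into (1, -i), the coefficients of `dval`. So the even vector encodes a
Neumann condition where a component starts and a Dirichlet condition where one ends; the odd vector
does the opposite. -/
theorem dotProduct_star_xEven (v : Fin 2 → ℂ) :
    v ⬝ᵥ star xEven = 0 ↔ dval v = 0 := by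
  have : v ⬝ᵥ star xEven = star xScalar * dval v := by
    simp [xEven_eq, dotProduct, Fin.sum_univ_two, dval_apply]; ring
  rw [this, mul_eq_zero, or_iff_right (star_ne_zero.2 xScalar_ne_zero)]

theorem dotProduct_star_xOdd (v : Fin 2 → ℂ) :
    v ⬝ᵥ star xOdd = 0 ↔ nval v = 0 := by
  have : v ⬝ᵥ star xOdd = star xScalar * (-Complex.I) * nval v := by
    simp [xOdd_eq, dotProduct, Fin.sum_univ_two, nval_apply]
    linear_combination (v 1 * (starRingEnd ℂ) xScalar) * Complex.I_sq
  rw [this, mul_eq_zero, or_iff_right]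
  exact mul_ne_zero (star_ne_zero.2 xScalar_ne_zero) (neg_ne_zero.2 Complex.I_ne_zero)

theorem xVec_ne_zero (a : ℝ) : xVec a ≠ 0 := by
  rw [xVec]
  split_ifs
  · rw [xEven_eq]; exact fun h => xScalar_ne_zero (by simpa using congrFun h 0)
  · rw [xOdd_eq]; exact fun h => xScalar_ne_zero (by simpa using congrFun h 1)

/-! ### Multiplicities -/

section Multiplicity

variable {n : ℕ} {α ℓ : Fin n → ℝ}

/-- The transfer map along the side `j` and through the vertex `j`. -/
def transfer (α ℓ : Fin n → ℝ) (σ : ℝ) (j : Fin n) : (Fin 2 → ℂ) →ₗ[ℂ] (Fin 2 → ℂ) :=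
  Matrix.toLin' (vertexMatrix (α j) * sideMatrix (ℓ j) σ)

theorem transfer_apply (σ : ℝ) (j : Fin n) (v : Fin 2 → ℂ) :
    transfer α ℓ σ j v = vertexMatrix (α j) *ᵥ (sideMatrix (ℓ j) σ *ᵥ v) := by
  rw [transfer, Matrix.toLin'_apply, mulVec_mulVec]

variable [NeZero n]

/-- The condition at the end `j` of an exceptional component. -/
def endFunctional {n : ℕ} (α ℓ : Fin n → ℝ) (σ : ℝ) (j : Fin n) : (Fin 2 → ℂ) →ₗ[ℂ] ℂ where
  toFun v := (sideMatrix (ℓ j) σ *ᵥ v) ⬝ᵥ star (xVec (α j))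
  map_add' v w := by rw [mulVec_add, add_dotProduct]
  map_smul' c v := by rw [mulVec_smul, smul_dotProduct]; rfl

theorem toLin'_polygonMatrix (σ : ℝ) :
    Matrix.toLin' (polygonMatrix α ℓ σ) = monodromy (transfer α ℓ σ) n :=
  reverse_prod_ofFn (n := n)
    ((Matrix.toLinAlgEquiv' : Matrix (Fin 2) (Fin 2) ℂ ≃ₐ[ℂ] _) :
      Matrix (Fin 2) (Fin 2) ℂ →* Module.End ℂ (Fin 2 → ℂ)) _

/-- A component ends with a side, whereas `transfer` ends with a vertex. The last side is split off
here and absorbed by `endFunctional`. -/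
theorem pathMatrix_mulVec (σ : ℝ) (s : Fin n) (m : ℕ) :
    pathMatrix α ℓ σ s m *ᵥ xVec (α s) = sideMatrix (ℓ (step s (m + 1))) σ *ᵥ
      pathVec (transfer α ℓ σ) (fun j => xVec (α j)) s m := by
  induction m with
  | zero => rfl
  | succ m ih =>
    rw [pathMatrix, ← mulVec_mulVec, ih, ← mulVec_mulVec, pathVec, transfer_apply]

theorem solvesComponent_iff {s : Fin n} (hs : IsExceptional (α s)) (σ : ℝ) :
    SolvesComponent α ℓ σ s ↔ endFunctional α ℓ σ (nextExceptional α s)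
      (pathVec (transfer α ℓ σ) (fun j => xVec (α j)) s (compSize α s - 1)) = 0 := by
  rw [SolvesComponent, componentMatrix, pathMatrix_mulVec,
    Nat.sub_add_cancel (compSize_spec hs).1]
  rfl

theorem mem_coefSpace {σ : ℝ} {p : Fin n → Fin 2 → ℂ} :
    p ∈ coefSpace α ℓ σ ↔ ∀ j,
      (Real.sin (Real.pi ^ 2 / (4 * α j)) : ℂ) * p (j + 1) 0 =
        (Real.cos (Real.pi ^ 2 / (4 * α j)) : ℂ) * sol σ (p j) (ℓ j) ∧
      (Real.cos (Real.pi ^ 2 / (4 * α j)) : ℂ) * p (j + 1) 1 =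
        (Real.sin (Real.pi ^ 2 / (4 * α j)) : ℂ) * sol' σ (p j) (ℓ j) := by
  simp only [← sol_zero_right σ (p _), ← sol'_zero_right σ (p _)]
  rfl

theorem mem_coefSpace_iff_amplitude {σ : ℝ} (hσ : σ ≠ 0) {p : Fin n → Fin 2 → ℂ} :
    p ∈ coefSpace α ℓ σ ↔ ∀ j,
      (Real.sin (Real.pi ^ 2 / (4 * α j)) : ℂ) * dval (amplitude hσ (p (j + 1))) =
        (Real.cos (Real.pi ^ 2 / (4 * α j)) : ℂ) *
          dval (sideMatrix (ℓ j) σ *ᵥ amplitude hσ (p j)) ∧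
      (Real.cos (Real.pi ^ 2 / (4 * α j)) : ℂ) * nval (amplitude hσ (p (j + 1))) =
        (Real.sin (Real.pi ^ 2 / (4 * α j)) : ℂ) *
          nval (sideMatrix (ℓ j) σ *ᵥ amplitude hσ (p j)) := by
  have hσ' : Complex.I * σ ≠ 0 := mul_ne_zero Complex.I_ne_zero (by exact_mod_cast hσ)
  rw [mem_coefSpace]
  refine forall_congr' fun j => and_congr ?_ ?_
  · rw [dval_sideMatrix, dval_amplitude]
  -- Derivatives are iσ times `nval`; the factor cancels because σ ≠ 0.
  · conv_rhs => rw [← mul_right_inj' hσ', mul_left_comm, nval_amplitude,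
      mul_left_comm (Complex.I * (σ : ℂ)), nval_sideMatrix]

/-- With both coefficients nonzero the conditions determine `dval w` and `nval w`, hence w, and the
multipliers are those of the vertex matrix. -/
theorem matching_iff_of_not_exceptional {a : ℝ} (ha : 0 < a) (h : ¬IsExceptional a)
    {v w : Fin 2 → ℂ} :
    ((Real.sin (Real.pi ^ 2 / (4 * a)) : ℂ) * dval w =
        (Real.cos (Real.pi ^ 2 / (4 * a)) : ℂ) * dval v ∧
      (Real.cos (Real.pi ^ 2 / (4 * a)) : ℂ) * nval w =
        (Real.sin (Real.pi ^ 2 / (4 * a)) : ℂ) * nval v) ↔ w = vertexMatrix a *ᵥ v := by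
  obtain ⟨hs, hc⟩ := sin_cos_ne_zero ha h
  have hs' : (Real.sin (Real.pi ^ 2 / (4 * a)) : ℂ) ≠ 0 := by exact_mod_cast hs
  have hc' : (Real.cos (Real.pi ^ 2 / (4 * a)) : ℂ) ≠ 0 := by exact_mod_cast hc
  have e1 := dval_vertexMatrix ha h v
  have e2 := nval_vertexMatrix ha h v
  rw [jump, Complex.ofReal_div] at e1 e2
  rw [inv_div] at e2
  constructor
  · rintro ⟨h1, h2⟩
    apply ext_dval_nval
    · rw [e1, div_mul_eq_mul_div, eq_div_iff hs', mul_comm, h1]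
    · rw [e2, div_mul_eq_mul_div, eq_div_iff hc', mul_comm, h2]
  · rintro rfl
    rw [e1, e2]
    constructor <;> field_simp

theorem coefSpace_eq_cycSpace (hα : ∀ j, 0 < α j) (hex : ∀ j, ¬IsExceptional (α j)) {σ : ℝ}
    (hσ : σ ≠ 0) :
    coefSpace α ℓ σ = (cycSpace (transfer α ℓ σ)).comap
      (LinearEquiv.piCongrRight fun _ => amplitude hσ).toLinearMap := by
  ext p
  rw [mem_coefSpace_iff_amplitude hσ]
  refine forall_congr' fun j => ?_
  change _ ↔ amplitude hσ (p (j + 1)) = transfer α ℓ σ j (amplitude hσ (p j))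
  rw [transfer_apply]
  exact matching_iff_of_not_exceptional (hα j) (hex j)

/-- At an exceptional vertex one of the two coefficients vanishes, so one condition concerns only
the outgoing side (membership in a line) and the other only the incoming side (orthogonality). -/
theorem coefSpace_eq_boundarySpace (hα : ∀ j, 0 < α j) {σ : ℝ} (hσ : σ ≠ 0) :
    coefSpace α ℓ σ =
      (boundarySpace α (transfer α ℓ σ) (fun j => xVec (α j)) (endFunctional α ℓ σ)).comap
        (LinearEquiv.piCongrRight fun _ => amplitude hσ).toLinearMap := by
  ext p
  rw [mem_coefSpace_iff_amplitude hσ]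
  refine forall_congr' fun j => ?_
  change _ ↔ (_ → amplitude hσ (p (j + 1)) = transfer α ℓ σ j (amplitude hσ (p j))) ∧
    (_ → amplitude hσ (p (j + 1)) ∈ Submodule.span ℂ {xVec (α j)} ∧
      (sideMatrix (ℓ j) σ *ᵥ amplitude hσ (p j)) ⬝ᵥ star (xVec (α j)) = 0)
  by_cases hex : IsExceptional (α j)
  · simp only [hex, not_true_eq_false, false_imp_iff, true_and, forall_const]
    rcases exceptional_cases (hα j) hex with ⟨h1, h2, h3⟩ | ⟨h1, h2, h3⟩
    · have h3' : (Real.cos (Real.pi ^ 2 / (4 * α j)) : ℂ) ≠ 0 := by exact_mod_cast h3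
      rw [xVec, if_pos h1, mem_span_xEven, dotProduct_star_xEven, h2]
      simp only [Complex.ofReal_zero, zero_mul, zero_eq_mul, mul_eq_zero, h3', false_or]
      exact and_comm
    · have h3' : (Real.sin (Real.pi ^ 2 / (4 * α j)) : ℂ) ≠ 0 := by exact_mod_cast h3
      rw [xVec, if_neg (by rw [h1]; norm_num), mem_span_xOdd, dotProduct_star_xOdd, h2]
      simp only [Complex.ofReal_zero, zero_mul, zero_eq_mul, mul_eq_zero, h3', false_or]
  · simp only [hex, not_false_eq_true, forall_const, false_imp_iff, and_true]
    rw [transfer_apply]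
    exact matching_iff_of_not_exceptional (hα j) hex

theorem isQuasiEigenvalue_iff_of_exists (hex : ∃ j, IsExceptional (α j)) {σ : ℝ} (hσ : 0 ≤ σ) :
    IsQuasiEigenvalue α ℓ σ ↔ ∃ s, IsExceptional (α s) ∧ SolvesComponent α ℓ σ s := by
  rw [IsQuasiEigenvalue, if_pos hex, and_iff_right hσ]

theorem isQuasiEigenvalue_iff_of_not (hex : ¬∃ j, IsExceptional (α j)) {σ : ℝ} (hσ : 0 ≤ σ) :
    IsQuasiEigenvalue α ℓ σ ↔
      Module.End.HasEigenvalue (Matrix.toLin' (polygonMatrix α ℓ σ)) 1 := by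
  rw [IsQuasiEigenvalue, if_neg hex, and_iff_right hσ]

theorem finrank_coefSpace_of_pos (hα : ∀ j, 0 < α j) {σ : ℝ} (hσ : 0 < σ) :
    Module.finrank ℂ (coefSpace α ℓ σ) = quasiMultiplicity α ℓ σ := by
  by_cases hex : ∃ j, IsExceptional (α j)
  · have hcount : Module.finrank ℂ (coefSpace α ℓ σ) =
        {s : Fin n | IsExceptional (α s) ∧ SolvesComponent α ℓ σ s}.ncard := by
      rw [coefSpace_eq_boundarySpace hα hσ.ne',
        (LinearEquiv.ofSubmodule' _ _).finrank_eq, finrank_boundarySpace α hex]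
      congr 1
      ext s
      refine and_congr_right fun hs => ?_
      rw [solvesComponent_iff hs, and_iff_right (xVec_ne_zero _)]
    rw [hcount, quasiMultiplicity, if_pos hex, if_neg hσ.ne']
    by_cases h : IsQuasiEigenvalue α ℓ σ
    · rw [if_pos h]
    · rw [if_neg h]
      rw [isQuasiEigenvalue_iff_of_exists hex hσ.le] at h
      convert Set.ncard_empty (Fin n)
      exact Set.eq_empty_of_forall_notMem fun s hs => h ⟨s, hs⟩
  · have hcount : Module.finrank ℂ (coefSpace α ℓ σ) =
        Module.finrank ℂ (Module.End.eigenspace (Matrix.toLin' (polygonMatrix α ℓ σ)) 1) := by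
      rw [coefSpace_eq_cycSpace hα (not_exists.1 hex) hσ.ne',
        (LinearEquiv.ofSubmodule' _ _).finrank_eq, finrank_cycSpace, toLin'_polygonMatrix]
    rw [hcount, quasiMultiplicity, if_neg hex, if_neg hσ.ne']
    by_cases h : IsQuasiEigenvalue α ℓ σ
    · rw [if_pos h]
    · rw [if_neg h]
      rw [isQuasiEigenvalue_iff_of_not hex hσ.le, Module.End.hasEigenvalue_iff, not_not] at h
      rw [h, finrank_bot]

/-! #### The eigenvalue zero -/

/-- Eigenfunctions to the eigenvalue zero are constant on every edge. -/
theorem coefSpace_zero_deriv (hℓ : ∀ j, 0 < ℓ j) {p : Fin n → Fin 2 → ℂ}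
    (hp : p ∈ coefSpace α ℓ 0) (j : Fin n) : p j 1 = 0 := by
  -- For σ = 0 the solutions are affine, and f' f̄ grows by ℓ |f'|² along a side while vertices
  -- preserve it. Summing around the cycle forces every slope to vanish.
  have h : ∀ j, p (j + 1) 1 * star (p (j + 1) 0) =
      p j 1 * star (p j 0) + ((ℓ j * ‖p j 1‖ ^ 2 : ℝ) : ℂ) := by
    intro j
    rw [mul_star_eq_of_vertex (Real.sin_sq_add_cos_sq _) (mem_coefSpace.1 hp j).1
      (mem_coefSpace.1 hp j).2]
    simp [sol, sol', sn, ← Complex.mul_conj']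
    ring
  have hs : ∑ j, p (j + 1) 1 * star (p (j + 1) 0) = ∑ j, p j 1 * star (p j 0) :=
    Equiv.sum_comp (Equiv.addRight (1 : Fin n)) fun j => p j 1 * star (p j 0)
  rw [Finset.sum_congr rfl fun j _ => h j, Finset.sum_add_distrib, add_eq_left,
    ← Complex.ofReal_sum, Complex.ofReal_eq_zero] at hs
  have := (Finset.sum_eq_zero_iff_of_nonneg fun j _ => by have := hℓ j; positivity).1 hs j
    (Finset.mem_univ j)
  simpa [(hℓ j).ne'] using this

/-- Functions that are constant on every edge. -/
def edgeConst (n : ℕ) : (Fin n → ℂ) →ₗ[ℂ] Fin n → Fin 2 → ℂ where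
  toFun p j := ![p j, 0]
  map_add' p q := by ext j i; fin_cases i <;> simp
  map_smul' c p := by ext j i; fin_cases i <;> simp

theorem edgeConst_injective (n : ℕ) : Function.Injective (edgeConst n) := fun _ _ h =>
  funext fun j => congrFun (congrFun h j) 0

/-- For edgewise constants the derivative conditions are void, so only the value conditions remain.
`W` is left free because they are solved differently with and without exceptional angles. -/
theorem finrank_coefSpace_zero (hℓ : ∀ j, 0 < ℓ j) {W : Submodule ℂ (Fin n → ℂ)}
    (hW : ∀ p, p ∈ W ↔ ∀ j, (Real.sin (Real.pi ^ 2 / (4 * α j)) : ℂ) * p (j + 1) =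
      (Real.cos (Real.pi ^ 2 / (4 * α j)) : ℂ) * p j) :
    Module.finrank ℂ (coefSpace α ℓ 0) = Module.finrank ℂ W := by
  have : coefSpace α ℓ 0 = W.map (edgeConst n) := by
    ext p
    constructor
    · intro hp
      have h0 := coefSpace_zero_deriv hℓ hp
      refine ⟨fun j => p j 0, (hW _).2 fun j => ?_, ?_⟩
      · have := (mem_coefSpace.1 hp j).1
        simpa [sol, h0] using this
      · ext j i
        fin_cases i
        · rfl
        · exact (h0 j).symm
    · rintro ⟨q, hq, rfl⟩
      refine mem_coefSpace.2 fun j => ?_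
      have := (hW q).1 hq j
      simpa [sol, sol', edgeConst] using this
  rw [this]
  exact (Submodule.equivMapOfInjective _ (edgeConst_injective n) W).finrank_eq.symm

/-- Multiplication by the jump factors of function values. -/
def jumpMap (α : Fin n → ℝ) (j : Fin n) : ℂ →ₗ[ℂ] ℂ := (jump (α j) : ℂ) • LinearMap.id

theorem jump_matching_iff {a : ℝ} (ha : 0 < a) (h : ¬IsExceptional a) {p q : ℂ} :
    (Real.sin (Real.pi ^ 2 / (4 * a)) : ℂ) * q = (Real.cos (Real.pi ^ 2 / (4 * a)) : ℂ) * p ↔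
      q = jump a * p := by
  have hs' : (Real.sin (Real.pi ^ 2 / (4 * a)) : ℂ) ≠ 0 := by
    exact_mod_cast (sin_cos_ne_zero ha h).1
  rw [jump, Complex.ofReal_div, div_mul_eq_mul_div, eq_div_iff hs', mul_comm q]

theorem dval_monodromy (hα : ∀ j, 0 < α j) (hex : ∀ j, ¬IsExceptional (α j)) (v : Fin 2 → ℂ)
    (k : ℕ) : dval (monodromy (transfer α ℓ 0) k v) = monodromy (jumpMap α) k 1 * dval v := by
  induction k with
  | zero => exact (one_mul _).symm
  | succ k ih =>
    change dval (transfer α ℓ 0 _ (monodromy (transfer α ℓ 0) k v)) =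
      (jump (α (Fin.ofNat n k)) * monodromy (jumpMap α) k 1) * dval v
    rw [transfer_apply, dval_vertexMatrix (hα _) (hex _), sideMatrix_zero, one_mulVec, ih, mul_assoc]

theorem nval_monodromy (hα : ∀ j, 0 < α j) (hex : ∀ j, ¬IsExceptional (α j)) (v : Fin 2 → ℂ)
    (k : ℕ) :
    nval (monodromy (transfer α ℓ 0) k v) = (monodromy (jumpMap α) k 1)⁻¹ * nval v := by
  induction k with
  | zero => change nval v = (1 : ℂ)⁻¹ * nval v; simp
  | succ k ih =>
    change nval (transfer α ℓ 0 _ (monodromy (transfer α ℓ 0) k v)) =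
      (jump (α (Fin.ofNat n k)) * monodromy (jumpMap α) k 1)⁻¹ * nval v
    rw [transfer_apply, nval_vertexMatrix (hα _) (hex _), sideMatrix_zero, one_mulVec, ih, mul_inv,
      mul_assoc]

/-- Sides act trivially at σ = 0, so T(0) multiplies `dval` by the product P of the jumps and `nval`
by 1/P. It has eigenvalue 1 exactly when P = 1. -/
theorem hasEigenvalue_polygonMatrix_zero (hα : ∀ j, 0 < α j)
    (hex : ∀ j, ¬IsExceptional (α j)) :
    Module.End.HasEigenvalue (Matrix.toLin' (polygonMatrix α ℓ 0)) 1 ↔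
      monodromy (jumpMap α) n 1 = 1 := by
  rw [toLin'_polygonMatrix]
  constructor
  · intro h
    obtain ⟨v, hv⟩ := h.exists_hasEigenvector
    have hv1 := hv.apply_eq_smul
    rw [one_smul] at hv1
    by_contra hne
    refine hv.2 (ext_dval_nval ?_ ?_)
    · have := dval_monodromy (ℓ := ℓ) hα hex v n
      rw [hv1] at this
      rw [map_zero]
      by_contra h0
      exact hne (mul_right_cancel₀ h0 (by rw [one_mul]; exact this.symm))
    · have := nval_monodromy (ℓ := ℓ) hα hex v n
      rw [hv1] at this
      rw [map_zero]
      by_contra h0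
      exact hne (inv_eq_one.1 (mul_right_cancel₀ h0 (by rw [one_mul]; exact this.symm)))
  · intro h
    refine Module.End.hasEigenvalue_of_hasEigenvector (x := ![1, 0]) ⟨?_, ?_⟩
    · rw [Module.End.mem_eigenspace_iff, one_smul]
      apply ext_dval_nval
      · rw [dval_monodromy hα hex, h, one_mul]
      · rw [nval_monodromy hα hex, h, inv_one, one_mul]
    · intro h0; simpa using congrFun h0 0

/-- If P = 1, then T(0) is the identity with a two-dimensional fixed space, but only the `dval`
direction comes from an eigenfunction. This is why the multiplicity at zero is one. -/
theorem finrank_coefSpace_zero_of_not (hα : ∀ j, 0 < α j) (hℓ : ∀ j, 0 < ℓ j)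
    (hex : ¬∃ j, IsExceptional (α j)) :
    Module.finrank ℂ (coefSpace α ℓ 0) = quasiMultiplicity α ℓ 0 := by
  have hex' := not_exists.1 hex
  rw [finrank_coefSpace_zero hℓ (W := cycSpace (jumpMap α)) fun p =>
      forall_congr' fun j => (jump_matching_iff (hα j) (hex' j)).symm,
    finrank_cycSpace, quasiMultiplicity, if_neg hex, if_pos rfl]
  have key : ∀ w, monodromy (jumpMap α) n w = w * monodromy (jumpMap α) n 1 := fun w => by
    rw [← smul_eq_mul, ← map_smul, smul_eq_mul, mul_one]
  by_cases h : monodromy (jumpMap α) n 1 = 1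
  · rw [if_pos ((isQuasiEigenvalue_iff_of_not hex le_rfl).2
      ((hasEigenvalue_polygonMatrix_zero hα hex').2 h))]
    have : Module.End.eigenspace (monodromy (jumpMap α) n) 1 = ⊤ := by
      rw [Submodule.eq_top_iff']
      intro w
      rw [Module.End.mem_eigenspace_iff, key, h, mul_one, one_smul]
    rw [this, finrank_top, Module.finrank_self]
  · rw [if_neg fun hq => h ((hasEigenvalue_polygonMatrix_zero hα hex').1
      ((isQuasiEigenvalue_iff_of_not hex le_rfl).1 hq))]
    have : Module.End.eigenspace (monodromy (jumpMap α) n) 1 = ⊥ := by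
      rw [Submodule.eq_bot_iff]
      intro w hw
      rw [Module.End.mem_eigenspace_iff, key, one_smul] at hw
      by_contra h0
      exact h (mul_left_cancel₀ h0 (by rw [hw, mul_one]))
    rw [this, finrank_bot]

theorem not_exceptional_step {s : Fin n} {m : ℕ} (h1 : 1 ≤ m) (h2 : m < compSize α s) :
    ¬IsExceptional (α (step s m)) := fun h => by
  have := compSize_le h1 h
  omega

/-- On an exceptional component, the transfer at zero multiplies values and derivatives by
nonzero factors. -/
theorem pathVec_transfer_zero (hα : ∀ j, 0 < α j) (s : Fin n) (m : ℕ) (hm : m < compSize α s) :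
    (dval (pathVec (transfer α ℓ 0) (fun j => xVec (α j)) s m) = 0 ↔ dval (xVec (α s)) = 0) ∧
    (nval (pathVec (transfer α ℓ 0) (fun j => xVec (α j)) s m) = 0 ↔
      nval (xVec (α s)) = 0) := by
  induction m with
  | zero => exact ⟨Iff.rfl, Iff.rfl⟩
  | succ m ih =>
    have hne := not_exceptional_step (by omega) hm
    have hj : (jump (α (step s (m + 1))) : ℂ) ≠ 0 := by exact_mod_cast jump_ne_zero (hα _) hne
    rw [pathVec, transfer_apply, dval_vertexMatrix (hα _) hne, nval_vertexMatrix (hα _) hne,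
      sideMatrix_zero, one_mulVec, mul_eq_zero, mul_eq_zero, or_iff_right hj,
      or_iff_right (inv_ne_zero hj)]
    exact ih (by omega)

theorem dval_xVec_eq_zero (a : ℝ) : dval (xVec a) = 0 ↔ parity a ≠ 1 := by
  rw [xVec]
  split_ifs with h
  · rw [xEven_eq, map_smul, smul_eq_zero, or_iff_right xScalar_ne_zero, dval_apply]
    simp [h]
  · rw [xOdd_eq, map_smul, smul_eq_zero, or_iff_right xScalar_ne_zero, dval_apply]
    simp [h]

theorem nval_xVec_eq_zero (a : ℝ) : nval (xVec a) = 0 ↔ parity a = 1 := by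
  rw [xVec]
  split_ifs with h
  · rw [xEven_eq, map_smul, smul_eq_zero, or_iff_right xScalar_ne_zero, nval_apply]
    simp [h]
  · rw [xOdd_eq, map_smul, smul_eq_zero, or_iff_right xScalar_ne_zero, nval_apply]
    simp [h]

theorem dotProduct_star_xVec (a : ℝ) (v : Fin 2 → ℂ) : v ⬝ᵥ star (xVec a) = 0 ↔
    (parity a = 1 ∧ dval v = 0) ∨ (parity a ≠ 1 ∧ nval v = 0) := by
  rw [xVec]
  split_ifs with h
  · rw [dotProduct_star_xEven]; simp [h]
  · rw [dotProduct_star_xOdd]; simp [h]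

/-- Transport at σ = 0 preserves which of `dval`, `nval` vanishes: `nval` after an even start,
`dval` after an odd one. The end tests `dval` if even and `nval` if odd, so the test succeeds when
the parities differ. -/
theorem solvesComponent_zero_iff (hα : ∀ j, 0 < α j) {s : Fin n} (hs : IsExceptional (α s)) :
    SolvesComponent α ℓ 0 s ↔ parity (α s) ≠ parity (α (nextExceptional α s)) := by
  obtain ⟨h1, h2⟩ := pathVec_transfer_zero (ℓ := ℓ) hα s (compSize α s - 1)
    (by have := (compSize_spec hs).1; omega)
  rw [solvesComponent_iff hs]
  change (_ *ᵥ _) ⬝ᵥ star (xVec _) = 0 ↔ _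
  rw [sideMatrix_zero, one_mulVec, dotProduct_star_xVec, h1, h2, dval_xVec_eq_zero,
    nval_xVec_eq_zero]
  rcases exceptional_cases (hα _) hs with ⟨e1, -⟩ | ⟨e1, -⟩ <;>
  rcases exceptional_cases (hα _) (compSize_spec hs).2 with ⟨e2, -⟩ | ⟨e2, -⟩ <;>
  rw [e1, e2] <;> norm_num

open Classical in
/-- Components from even to odd vertices are as many as components from odd to even ones. -/
theorem ncard_parity_ne (hα : ∀ j, 0 < α j) :
    {s : Fin n | IsExceptional (α s) ∧ parity (α s) ≠ parity (α (nextExceptional α s))}.ncard =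
      2 * {s : Fin n | IsExceptional (α s) ∧ parity (α s) = 1 ∧
        parity (α (nextExceptional α s)) ≠ 1}.ncard := by
  set E : Finset (Fin n) := {s | IsExceptional (α s)} with hE
  have mem : ∀ s, s ∈ E ↔ IsExceptional (α s) := fun s => by simp [hE]
  -- `nextExceptional` permutes the exceptional vertices, so even ends are as many as even starts.
  have hsum : ∑ s ∈ E, (if parity (α (nextExceptional α s)) = 1 then (1 : ℤ) else 0) =
      ∑ s ∈ E, if parity (α s) = 1 then (1 : ℤ) else 0 :=
    Finset.sum_nbij' (nextExceptional α) (prevExceptional α)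
      (fun s hs => (mem _).2 (compSize_spec ((mem s).1 hs)).2)
      (fun s hs => (mem _).2 (prevDist_spec ⟨s, (mem s).1 hs⟩ s).2)
      (fun s hs => prevExceptional_nextExceptional ((mem s).1 hs))
      (fun s hs => nextExceptional_prevExceptional ((mem s).1 hs)) fun s _ => rfl
  have c1 : {s : Fin n | IsExceptional (α s) ∧
      parity (α s) ≠ parity (α (nextExceptional α s))}.ncard =
      (E.filter fun s => parity (α s) ≠ parity (α (nextExceptional α s))).card := by
    rw [← Set.ncard_coe_finset]; congr 1; ext s; simp [mem]
  have c2 : {s : Fin n | IsExceptional (α s) ∧ parity (α s) = 1 ∧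
      parity (α (nextExceptional α s)) ≠ 1}.ncard =
      (E.filter fun s => parity (α s) = 1 ∧ parity (α (nextExceptional α s)) ≠ 1).card := by
    rw [← Set.ncard_coe_finset]; congr 1; ext s; simp [mem]
  rw [c1, c2]
  zify
  rw [Finset.card_filter, Finset.card_filter]
  push_cast
  -- Pointwise, [parities differ] - 2 [even to odd] = [end even] - [start even], and the right-hand
  -- side sums to zero.
  refine eq_of_sub_eq_zero (Eq.trans ?_ (sub_eq_zero.2 hsum))
  rw [Finset.mul_sum, ← Finset.sum_sub_distrib, ← Finset.sum_sub_distrib]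
  refine Finset.sum_congr rfl fun s hs => ?_
  rw [mem] at hs
  rcases exceptional_cases (hα _) hs with ⟨e1, -⟩ | ⟨e1, -⟩ <;>
  rcases exceptional_cases (hα _) (compSize_spec hs).2 with ⟨e2, -⟩ | ⟨e2, -⟩ <;>
  rw [e1, e2] <;> norm_num

open Classical in
-- An edgewise constant function can be nonzero on a component only if its start leaves the value
-- free (even) and its end does not force it to vanish (odd).
theorem finrank_coefSpace_zero_of_exists (hα : ∀ j, 0 < α j) (hℓ : ∀ j, 0 < ℓ j)
    (hex : ∃ j, IsExceptional (α j)) :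
    Module.finrank ℂ (coefSpace α ℓ 0) = quasiMultiplicity α ℓ 0 := by
  -- Scalar boundary data: at an even vertex the value is free after it and zero before it; at an
  -- odd vertex it is zero after it and unrestricted before it.
  have hW := finrank_coefSpace_zero hℓ (W := boundarySpace α (jumpMap α)
    (fun j => if parity (α j) = 1 then (1 : ℂ) else 0)
    (fun j => if parity (α j) = 1 then LinearMap.id else 0)) fun p =>
      forall_congr' fun j => by
        by_cases hj : IsExceptional (α j)
        · simp only [hj, not_true_eq_false, false_imp_iff, true_and, forall_const]
          rcases exceptional_cases (hα j) hj with ⟨h1, h2, h3⟩ | ⟨h1, h2, h3⟩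
          · have h3' : (Real.cos (Real.pi ^ 2 / (4 * α j)) : ℂ) ≠ 0 := by exact_mod_cast h3
            rw [if_pos h1, if_pos h1, h2, Complex.ofReal_zero, zero_mul, zero_eq_mul,
              or_iff_right h3']
            refine and_iff_right ?_
            exact Submodule.mem_span_singleton.2 ⟨p (j + 1), by simp⟩
          · have h3' : (Real.sin (Real.pi ^ 2 / (4 * α j)) : ℂ) ≠ 0 := by exact_mod_cast h3
            have h1' : parity (α j) ≠ 1 := by rw [h1]; norm_num
            rw [if_neg h1', if_neg h1', h2, Complex.ofReal_zero, zero_mul, mul_eq_zero,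
              or_iff_right h3']
            simp
        · simp only [hj, not_false_eq_true, forall_const, false_imp_iff, and_true]
          exact (jump_matching_iff (hα j) hj).symm
  have hpath : ∀ s, parity (α s) = 1 → ∀ m < compSize α s, pathVec (jumpMap α)
      (fun j => if parity (α j) = 1 then (1 : ℂ) else 0) s m ≠ 0 := by
    intro s hs m
    induction m with
    | zero => intro _; simp [pathVec, hs]
    | succ m ih =>
      intro hm
      refine mul_ne_zero ?_ (ih (by omega))
      exact_mod_cast jump_ne_zero (hα _) (not_exceptional_step (by omega) hm)
  have hset : {s | IsExceptional (α s) ∧ (if parity (α s) = 1 then (1 : ℂ) else 0) ≠ 0 ∧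
      (if parity (α (nextExceptional α s)) = 1 then (LinearMap.id : ℂ →ₗ[ℂ] ℂ) else 0)
        (pathVec (jumpMap α) (fun j => if parity (α j) = 1 then (1 : ℂ) else 0) s
          (compSize α s - 1)) = 0} =
      {s : Fin n | IsExceptional (α s) ∧ parity (α s) = 1 ∧
        parity (α (nextExceptional α s)) ≠ 1} := by
    ext s
    refine and_congr_right fun hs => ?_
    by_cases h1 : parity (α s) = 1
    · have h2 := hpath s h1 (compSize α s - 1) (by have := (compSize_spec hs).1; omega)
      by_cases h3 : parity (α (nextExceptional α s)) = 1 <;> simp [h1, h2, h3]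
    · simp [h1]
  rw [hW, finrank_boundarySpace α hex, hset, quasiMultiplicity, if_pos hex, if_pos rfl,
    ncard_parity_ne hα, Nat.mul_div_cancel_left _ two_pos]
  by_cases h : IsQuasiEigenvalue α ℓ 0
  · rw [if_pos h]
  · rw [if_neg h]
    rw [isQuasiEigenvalue_iff_of_exists hex le_rfl] at h
    convert Set.ncard_empty (Fin n)
    refine Set.eq_empty_of_forall_notMem fun s hs => h ⟨s, hs.1, ?_⟩
    rw [solvesComponent_zero_iff hα hs.1, hs.2.1]
    exact hs.2.2.symm

theorem finrank_coefSpace (hα : ∀ j, 0 < α j) (hℓ : ∀ j, 0 < ℓ j) {σ : ℝ} (hσ : 0 ≤ σ) :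
    Module.finrank ℂ (coefSpace α ℓ σ) = quasiMultiplicity α ℓ σ := by
  rcases hσ.eq_or_lt with rfl | hσ
  · by_cases hex : ∃ j, IsExceptional (α j)
    · exact finrank_coefSpace_zero_of_exists hα hℓ hex
    · exact finrank_coefSpace_zero_of_not hα hℓ hex
  · exact finrank_coefSpace_of_pos hα hσ

end Multiplicity

/-! ### Phases of transported vectors -/

/-- The real waves with phase `θ`. -/
def phaseVec (θ : ℝ) : Fin 2 → ℂ :=
  ![Complex.exp (θ * Complex.I), Complex.I * Complex.exp (-(θ * Complex.I))]

theorem dval_phaseVec (θ : ℝ) : dval (phaseVec θ) = 2 * (Real.cos θ : ℂ) := by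
  rw [dval_apply, phaseVec, Complex.ofReal_cos, Complex.cos]
  simp only [cons_val_zero, cons_val_one, neg_mul]
  linear_combination (-Complex.exp (-(θ * Complex.I))) * Complex.I_sq

theorem nval_phaseVec (θ : ℝ) : nval (phaseVec θ) = 2 * Complex.I * (Real.sin θ : ℂ) := by
  rw [nval_apply, phaseVec, Complex.ofReal_sin, Complex.sin]
  simp only [cons_val_zero, cons_val_one, neg_mul]
  linear_combination (Complex.exp (θ * Complex.I)) * Complex.I_sq

/-- `g` has amplitudes proportional to `κ` and a continuous phase that grows at least with
slope `m`. -/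
def HasPhase (κ : ℂ) (m : ℝ) (g : ℝ → Fin 2 → ℂ) : Prop :=
  ∃ (θ r : ℝ → ℝ) (C : ℝ), Continuous θ ∧ (∀ σ, 0 < r σ) ∧ (∀ σ, m * σ - C ≤ θ σ) ∧
    ∀ σ, g σ = (κ * r σ) • phaseVec (θ σ)

theorem hasPhase_const (κ : ℂ) (θ : ℝ) : HasPhase κ 0 fun _ => κ • phaseVec θ :=
  ⟨fun _ => θ, fun _ => 1, -θ, continuous_const, fun _ => one_pos, fun σ => by simp, fun σ => by
    simp⟩

theorem HasPhase.side {κ : ℂ} {m : ℝ} {g : ℝ → Fin 2 → ℂ} (h : HasPhase κ m g) (l : ℝ) :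
    HasPhase κ (m + l) fun σ => sideMatrix l σ *ᵥ g σ := by
  obtain ⟨θ, r, C, hθ, hr, hC, hg⟩ := h
  refine ⟨fun σ => θ σ + l * σ, r, C, by fun_prop, hr, fun σ => by linarith [hC σ], fun σ => ?_⟩
  beta_reduce
  rw [hg, mulVec_smul, sideMatrix_mulVec]
  congr 1
  ext i
  fin_cases i
  · simp only [phaseVec, Fin.zero_eta, cons_val_zero]
    rw [← Complex.exp_add]; congr 1; push_cast; ring
  · simp only [phaseVec, Fin.mk_one, cons_val_one, cons_val_fin_one]
    rw [mul_left_comm, ← Complex.exp_add]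
    congr 2; push_cast; ring

/-- Real waves are the vectors (z, i z̄); the polar form of z gives their size and phase. -/
theorem smul_phaseVec {z : ℂ} {r φ : ℝ} (hz : z = r * Complex.exp (φ * Complex.I)) :
    (r : ℂ) • phaseVec φ = ![z, Complex.I * (starRingEnd ℂ) z] := by
  have : (starRingEnd ℂ) z = r * Complex.exp (-(φ * Complex.I)) := by
    rw [hz, map_mul, Complex.conj_ofReal, ← Complex.exp_conj, map_mul, Complex.conj_ofReal,
      Complex.conj_I, mul_neg]
  rw [this, hz]
  ext i
  fin_cases i
  · simp [phaseVec]
  · simp [phaseVec]; ring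

/-- With c = cos μ and b = csc μ, the vertex matrix replaces z = e^{iθ} by b e^{iθ}(1 + c e^{-2iθ}).
Since |c| < 1, the last factor stays in the right half-plane, so its argument is continuous and
bounded, and the growth of the phase is unaffected. -/
theorem HasPhase.vertex {κ : ℂ} {m : ℝ} {g : ℝ → Fin 2 → ℂ} (h : HasPhase κ m g) {a : ℝ}
    (ha : 0 < a) (hex : ¬IsExceptional a) : HasPhase κ m fun σ => vertexMatrix a *ᵥ g σ := by
  obtain ⟨θ, r, C, hθ, hr, hC, hg⟩ := h
  have hsin : Real.sin (angleMu a) ≠ 0 := by rwa [isExceptional_iff ha] at hex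
  set c := Real.cos (angleMu a) with hc
  set b := 1 / Real.sin (angleMu a) with hb
  have hb0 : b ≠ 0 := one_div_ne_zero hsin
  have hc1 : |c| < 1 := by
    rw [← sq_lt_one_iff_abs_lt_one]
    have := Real.sin_sq_add_cos_sq (angleMu a)
    have := sq_pos_of_ne_zero hsin
    nlinarith
  let q : ℝ → ℂ := fun σ => 1 + c * Complex.exp (-(2 * θ σ * Complex.I))
  have hq : ∀ σ, q σ ∈ Complex.slitPlane := fun σ => by
    left
    have h1 : |(c * Complex.exp (-(2 * θ σ * Complex.I))).re| < 1 := by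
      refine (Complex.abs_re_le_norm _).trans_lt ?_
      have h2 : ‖Complex.exp (-(2 * θ σ * Complex.I))‖ = 1 := by
        have := Complex.norm_exp_ofReal_mul_I (-(2 * θ σ))
        rw [← this]; congr 2; push_cast; ring
      rw [norm_mul, h2, mul_one, Complex.norm_real]
      exact hc1
    have := (abs_lt.1 h1).1
    simp only [q, Complex.add_re, Complex.one_re]
    linarith
  have hqc : Continuous q := by fun_prop
  -- Both added arguments exceed -π, hence the loss of 2π; the argument of the real number b
  -- accounts for its sign.
  refine ⟨fun σ => θ σ + (q σ).arg + (b : ℂ).arg, fun σ => r σ * (|b| * ‖q σ‖), C + 2 * Real.pi,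
    ?_, ?_, ?_, ?_⟩
  · refine (hθ.add ?_).add continuous_const
    exact continuous_iff_continuousAt.2 fun σ =>
      (Complex.continuousAt_arg (hq σ)).comp hqc.continuousAt
  · intro σ
    have := hr σ
    have : 0 < ‖q σ‖ := norm_pos_iff.2 (Complex.slitPlane_ne_zero (hq σ))
    positivity
  · intro σ
    have h1 := Complex.neg_pi_lt_arg (q σ)
    have h2 := Complex.neg_pi_lt_arg (b : ℂ)
    have := hC σ
    linarith
  · intro σ
    have hz : (b * Complex.exp (θ σ * Complex.I) * q σ : ℂ) =
        ((|b| * ‖q σ‖ : ℝ) : ℂ) *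
          Complex.exp ((θ σ + (q σ).arg + (b : ℂ).arg : ℝ) * Complex.I) := by
      have e1 := Complex.norm_mul_exp_arg_mul_I (q σ)
      have e2 := Complex.norm_mul_exp_arg_mul_I (b : ℂ)
      rw [Complex.norm_real, Real.norm_eq_abs] at e2
      push_cast
      rw [add_mul, add_mul, Complex.exp_add, Complex.exp_add]
      nth_rw 1 [← e1, ← e2]
      ring
    have e : ∀ σ, (κ * ((r σ * (|b| * ‖q σ‖) : ℝ) : ℂ)) = κ * r σ * ((|b| * ‖q σ‖ : ℝ) : ℂ) :=
      fun σ => by push_cast; ring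
    beta_reduce
    rw [hg, mulVec_smul, e, mul_smul (κ * (r σ : ℂ)), smul_phaseVec hz]
    congr 1
    have h2 : Complex.exp (θ σ * Complex.I) * Complex.exp (-(2 * θ σ * Complex.I)) =
        Complex.exp (-(θ σ * Complex.I)) := by rw [← Complex.exp_add]; congr 1; ring
    have h3 : Complex.exp (-(θ σ * Complex.I)) * Complex.exp (2 * θ σ * Complex.I) =
        Complex.exp (θ σ * Complex.I) := by rw [← Complex.exp_add]; congr 1; ring
    have hconj : (starRingEnd ℂ) (b * Complex.exp (θ σ * Complex.I) * q σ) =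
        b * Complex.exp (-(θ σ * Complex.I)) * (1 + c * Complex.exp (2 * θ σ * Complex.I)) := by
      simp only [q, map_mul, map_add, map_one, Complex.conj_ofReal, ← Complex.exp_conj, map_neg,
        Complex.conj_I, mul_neg, neg_neg, map_ofNat]
    have hcb : ((c / Real.sin (angleMu a) : ℝ) : ℂ) = b * c := by
      rw [hb]; push_cast; ring
    rw [hconj]
    ext i
    fin_cases i
    · simp only [vertexMatrix, phaseVec, mulVec, dotProduct, Fin.sum_univ_two, of_apply, cons_val',
        cons_val_zero, cons_val_one, cons_val_fin_one, Fin.zero_eta, q, ← hc, ← hb, hcb]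
      linear_combination (-(b * c : ℂ)) * h2 -
        (b * c * Complex.exp (-(θ σ * Complex.I)) : ℂ) * Complex.I_sq
    · simp only [vertexMatrix, phaseVec, mulVec, dotProduct, Fin.sum_univ_two, of_apply, cons_val',
        cons_val_zero, cons_val_one, cons_val_fin_one, Fin.mk_one, ← hc, ← hb, hcb]
      linear_combination (-(Complex.I * b * c : ℂ)) * h3

/-- The phase tends to infinity, so by the intermediate value theorem it takes every sufficiently
large value beyond R. -/
theorem exists_phase_eq {θ : ℝ → ℝ} (hθ : Continuous θ) {m C : ℝ} (hm : 0 < m)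
    (h : ∀ σ, m * σ - C ≤ θ σ) (R : ℝ) : ∃ T, ∀ t ≥ T, ∃ σ > R, θ σ = t := by
  refine ⟨θ (R + 1), fun t ht => ?_⟩
  set b := max (R + 1) ((t + C) / m)
  have hb : t ≤ θ b := by
    have h1 := h b
    have h2 : (t + C) / m ≤ b := le_max_right _ _
    rw [div_le_iff₀ hm] at h2
    linarith
  obtain ⟨σ, hσ, rfl⟩ := intermediate_value_Icc (le_max_left (R + 1) ((t + C) / m))
    hθ.continuousOn ⟨ht, hb⟩
  exact ⟨σ, by linarith [hσ.1], rfl⟩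

theorem exists_nat_mul_pi_ge (T : ℝ) : ∃ k : ℕ, T ≤ k * (2 * Real.pi) := by
  obtain ⟨k, hk⟩ := exists_nat_ge (T / (2 * Real.pi))
  exact ⟨k, (div_le_iff₀ (by positivity)).1 hk⟩

/-! ### Analytic dependence on the spectral parameter -/

/-- Coordinatewise analyticity. -/
def AnalyticVec (g : ℝ → Fin 2 → ℂ) : Prop := ∀ i, AnalyticOnNhd ℝ (fun σ => g σ i) Set.univ

theorem analyticVec_const (v : Fin 2 → ℂ) : AnalyticVec fun _ => v := fun _ =>
  analyticOnNhd_const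

theorem analyticAt_ofReal (x : ℝ) : AnalyticAt ℝ (fun σ : ℝ => (σ : ℂ)) x :=
  Complex.ofRealCLM.analyticAt x

theorem AnalyticVec.side {g : ℝ → Fin 2 → ℂ} (h : AnalyticVec g) (l : ℝ) :
    AnalyticVec fun σ => sideMatrix l σ *ᵥ g σ := by
  intro i σ _
  simp only [sideMatrix_mulVec]
  have h1 : AnalyticAt ℝ (fun σ : ℝ => Complex.I * l * σ) σ :=
    analyticAt_const.mul (analyticAt_ofReal σ)
  fin_cases i
  · exact ((analyticAt_cexp.restrictScalars).fun_comp h1).mul (h 0 σ trivial)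
  · exact ((analyticAt_cexp.restrictScalars).fun_comp h1.neg).mul (h 1 σ trivial)

theorem AnalyticVec.mulVec {g : ℝ → Fin 2 → ℂ} (h : AnalyticVec g)
    (M : Matrix (Fin 2) (Fin 2) ℂ) : AnalyticVec fun σ => M *ᵥ g σ := by
  intro i σ _
  simp only [Matrix.mulVec, dotProduct, Fin.sum_univ_two]
  exact (analyticAt_const.mul (h 0 σ trivial)).add (analyticAt_const.mul (h 1 σ trivial))

/-- Infinitely many zeros in a compact interval would accumulate, and the identity theorem would
make the function vanish. -/
theorem finite_zeros {f : ℝ → ℂ} (hf : AnalyticOnNhd ℝ f Set.univ) (hne : ∃ x, f x ≠ 0)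
    (R : ℝ) : {x | x ∈ Set.Icc 0 R ∧ f x = 0}.Finite := by
  by_contra hinf
  obtain ⟨x, -, hx⟩ := Set.Infinite.exists_accPt_of_subset_isCompact hinf
    (isCompact_Icc (a := (0 : ℝ)) (b := R)) fun x hx => hx.1
  obtain ⟨y, hy⟩ := hne
  refine hy (hf.eqOn_zero_of_preconnected_of_frequently_eq_zero isPreconnected_univ
    (Set.mem_univ x) ?_ (Set.mem_univ y))
  exact (accPt_iff_frequently_nhdsNE.1 hx).mono fun _ h => h.2

/-! ### Distribution of the quasi-eigenvalues -/

section Distribution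

variable {n : ℕ} [NeZero n] {α ℓ : Fin n → ℝ}

theorem analyticVec_pathVec (s : Fin n) (m : ℕ) :
    AnalyticVec fun σ => pathVec (transfer α ℓ σ) (fun j => xVec (α j)) s m := by
  induction m with
  | zero => exact analyticVec_const _
  | succ m ih =>
    simp only [pathVec, transfer_apply]
    exact (ih.side _).mulVec _

theorem analyticVec_monodromy (v : Fin 2 → ℂ) (k : ℕ) :
    AnalyticVec fun σ => monodromy (transfer α ℓ σ) k v := by
  induction k with
  | zero => exact analyticVec_const _
  | succ k ih =>
    simp only [monodromy, LinearMap.comp_apply, transfer_apply]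
    exact (ih.side _).mulVec _

theorem exists_xVec_eq (a : ℝ) : ∃ θ, xVec a = xScalar • phaseVec θ := by
  rw [xVec]
  split_ifs
  · refine ⟨0, ?_⟩
    rw [xEven_eq]; simp [phaseVec]
  · refine ⟨Real.pi / 2, ?_⟩
    have h : Complex.exp ((Real.pi / 2 : ℝ) * Complex.I) = Complex.I := by
      push_cast; exact Complex.exp_pi_div_two_mul_I
    rw [xOdd_eq, phaseVec, Complex.exp_neg, h]; simp

theorem hasPhase_pathVec (hα : ∀ j, 0 < α j) (hℓ : ∀ j, 0 < ℓ j) (s : Fin n) (m : ℕ)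
    (hm : m < compSize α s) : ∃ c ≥ 0, HasPhase xScalar c fun σ =>
      pathVec (transfer α ℓ σ) (fun j => xVec (α j)) s m := by
  induction m with
  | zero =>
    obtain ⟨θ, hθ⟩ := exists_xVec_eq (α s)
    refine ⟨0, le_rfl, ?_⟩
    simp only [pathVec, hθ]
    exact hasPhase_const _ _
  | succ m ih =>
    obtain ⟨c, hc, h⟩ := ih (by omega)
    refine ⟨c + ℓ (step s (m + 1)), by linarith [hℓ (step s (m + 1))], ?_⟩
    simp only [pathVec, transfer_apply]
    exact (h.side _).vertex (hα _) (not_exceptional_step (by omega) hm)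

theorem hasPhase_monodromy (hα : ∀ j, 0 < α j) (hℓ : ∀ j, 0 < ℓ j)
    (hex : ∀ j, ¬IsExceptional (α j)) (θ : ℝ) (k : ℕ) : ∃ c ≥ 0, (0 < k → 0 < c) ∧
      HasPhase 1 c fun σ => monodromy (transfer α ℓ σ) k (phaseVec θ) := by
  induction k with
  | zero =>
    refine ⟨0, le_rfl, fun h => absurd h (lt_irrefl 0), ?_⟩
    have := hasPhase_const 1 θ
    simpa [monodromy] using this
  | succ k ih =>
    obtain ⟨c, hc, -, h⟩ := ih
    have := hℓ (Fin.ofNat n k)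
    refine ⟨c + ℓ (Fin.ofNat n k), by linarith, fun _ => by linarith, ?_⟩
    simp only [monodromy, LinearMap.comp_apply, transfer_apply]
    exact (h.side _).vertex (hα _) (hex _)

/-- The left-hand side of the quasi-eigenvalue equation of an exceptional component. -/
def componentEq (α ℓ : Fin n → ℝ) (s : Fin n) (σ : ℝ) : ℂ :=
  endFunctional α ℓ σ (nextExceptional α s)
    (pathVec (transfer α ℓ σ) (fun j => xVec (α j)) s (compSize α s - 1))

theorem analyticOnNhd_componentEq (s : Fin n) : AnalyticOnNhd ℝ (componentEq α ℓ s) Set.univ := by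
  intro σ _
  have h := (analyticVec_pathVec (α := α) (ℓ := ℓ) s (compSize α s - 1)).side
    (ℓ (nextExceptional α s))
  change AnalyticAt ℝ (fun σ => (sideMatrix (ℓ (nextExceptional α s)) σ *ᵥ _) ⬝ᵥ
    star (xVec (α (nextExceptional α s)))) σ
  simp only [dotProduct, Fin.sum_univ_two]
  exact ((h 0 σ trivial).mul analyticAt_const).add ((h 1 σ trivial).mul analyticAt_const)

/-- In terms of the phase θ at the end of the component, the equation reads cos θ = 0 or sin θ = 0,
according to the parity of the end vertex. -/
theorem componentEq_zeros (hα : ∀ j, 0 < α j) (hℓ : ∀ j, 0 < ℓ j) {s : Fin n}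
    (hs : IsExceptional (α s)) :
    (∀ R, ∃ σ > R, componentEq α ℓ s σ = 0) ∧ ∃ σ, componentEq α ℓ s σ ≠ 0 := by
  obtain ⟨c, hc, h⟩ := hasPhase_pathVec hα hℓ s (compSize α s - 1)
    (by have := (compSize_spec hs).1; omega)
  obtain ⟨θ, r, C, hθ, hr, hC, hg⟩ := h.side (ℓ (nextExceptional α s))
  beta_reduce at hg
  have hm : 0 < c + ℓ (nextExceptional α s) := by linarith [hℓ (nextExceptional α s)]
  have hκ : ∀ σ, xScalar * r σ ≠ 0 := fun σ =>
    mul_ne_zero xScalar_ne_zero (by exact_mod_cast (hr σ).ne')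
  have key : ∀ σ, componentEq α ℓ s σ = 0 ↔
      (parity (α (nextExceptional α s)) = 1 ∧ Real.cos (θ σ) = 0) ∨
      (parity (α (nextExceptional α s)) ≠ 1 ∧ Real.sin (θ σ) = 0) := by
    intro σ
    change (sideMatrix (ℓ (nextExceptional α s)) σ *ᵥ _) ⬝ᵥ star (xVec _) = 0 ↔ _
    rw [dotProduct_star_xVec, hg, map_smul, map_smul, smul_eq_zero, smul_eq_zero,
      or_iff_right (hκ σ), or_iff_right (hκ σ), dval_phaseVec, nval_phaseVec]
    simp only [mul_eq_zero, OfNat.ofNat_ne_zero, false_or, Complex.I_ne_zero,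
      Complex.ofReal_eq_zero]
  have per : ∀ R φ, 0 ≤ φ → ∃ σ > R, Real.cos (θ σ) = Real.cos φ ∧ Real.sin (θ σ) = Real.sin φ := by
    intro R φ hφ
    obtain ⟨T, hT⟩ := exists_phase_eq hθ hm hC R
    obtain ⟨k, hk⟩ := exists_nat_mul_pi_ge T
    obtain ⟨σ, hσ, he⟩ := hT (φ + k * (2 * Real.pi)) (by linarith)
    exact ⟨σ, hσ, by rw [he, Real.cos_add_nat_mul_two_pi], by rw [he, Real.sin_add_nat_mul_two_pi]⟩
  by_cases hp : parity (α (nextExceptional α s)) = 1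
  · refine ⟨fun R => ?_, ?_⟩
    · obtain ⟨σ, hσ, h1, -⟩ := per R (Real.pi / 2) (by positivity)
      exact ⟨σ, hσ, (key σ).2 (Or.inl ⟨hp, by rw [h1, Real.cos_pi_div_two]⟩)⟩
    · obtain ⟨σ, -, h1, -⟩ := per 0 0 le_rfl
      exact ⟨σ, fun h0 => by simpa [hp, h1] using (key σ).1 h0⟩
  · refine ⟨fun R => ?_, ?_⟩
    · obtain ⟨σ, hσ, -, h1⟩ := per R 0 le_rfl
      exact ⟨σ, hσ, (key σ).2 (Or.inr ⟨hp, by rw [h1, Real.sin_zero]⟩)⟩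
    · obtain ⟨σ, -, -, h1⟩ := per 0 (Real.pi / 2) (by positivity)
      exact ⟨σ, fun h0 => by simpa [hp, h1] using (key σ).1 h0⟩

/-! ### The trace of T(σ). -/

/-- The matrices of `SU(1, 1)`. -/
def IsSU (M : Matrix (Fin 2) (Fin 2) ℂ) : Prop :=
  M 1 1 = (starRingEnd ℂ) (M 0 0) ∧ M 1 0 = (starRingEnd ℂ) (M 0 1) ∧ M.det = 1

theorem isSU_one : IsSU 1 := by simp [IsSU]

theorem IsSU.mul {M N : Matrix (Fin 2) (Fin 2) ℂ} (hM : IsSU M) (hN : IsSU N) :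
    IsSU (M * N) := by
  obtain ⟨a1, a2, a3⟩ := hM
  obtain ⟨b1, b2, b3⟩ := hN
  refine ⟨?_, ?_, by rw [det_mul, a3, b3, one_mul]⟩ <;>
  · simp only [mul_apply, Fin.sum_univ_two, a1, a2, b1, b2, map_add, map_mul, Complex.conj_conj]
    ring

theorem isSU_sideMatrix (l σ : ℝ) : IsSU (sideMatrix l σ) := by
  refine ⟨?_, by simp [sideMatrix], ?_⟩
  · simp [sideMatrix, ← Complex.exp_conj]
  · simp [sideMatrix, det_fin_two, ← Complex.exp_add]

theorem isSU_vertexMatrix {a : ℝ} (ha : 0 < a) (hex : ¬IsExceptional a) :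
    IsSU (vertexMatrix a) := by
  have hsin : Real.sin (angleMu a) ≠ 0 := by rwa [isExceptional_iff ha] at hex
  have key : ((1 / Real.sin (angleMu a) : ℝ) : ℂ) ^ 2 -
      ((Real.cos (angleMu a) / Real.sin (angleMu a) : ℝ) : ℂ) ^ 2 = 1 := by
    have : (1 / Real.sin (angleMu a)) ^ 2 - (Real.cos (angleMu a) / Real.sin (angleMu a)) ^ 2 =
        1 := by
      field_simp
      linarith [Real.sin_sq_add_cos_sq (angleMu a)]
    exact_mod_cast this
  rw [vertexMatrix]
  generalize ((1 / Real.sin (angleMu a) : ℝ)) = x at *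
  generalize (Real.cos (angleMu a) / Real.sin (angleMu a) : ℝ) = y at *
  refine ⟨by simp, by simp, ?_⟩
  rw [det_fin_two]
  simp only [of_apply, cons_val', cons_val_zero, cons_val_one, cons_val_fin_one]
  linear_combination key + (y : ℂ) ^ 2 * Complex.I_sq

theorem isSU_polygonMatrix {n : ℕ} {α ℓ : Fin n → ℝ} (hα : ∀ j, 0 < α j)
    (hex : ∀ j, ¬IsExceptional (α j)) (σ : ℝ) : IsSU (polygonMatrix α ℓ σ) := by
  refine List.prod_induction IsSU (fun _ _ => IsSU.mul) isSU_one fun M hM => ?_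
  rw [List.mem_reverse, List.mem_ofFn] at hM
  obtain ⟨j, rfl⟩ := hM
  exact (isSU_vertexMatrix (hα j) (hex j)).mul (isSU_sideMatrix _ _)

theorem IsSU.trace_of_mulVec {M : Matrix (Fin 2) (Fin 2) ℂ} (hM : IsSU M) {v : Fin 2 → ℂ}
    (hv : v ≠ 0) {z : ℂ} (h : M *ᵥ v = z • v) : z ^ 2 - z * M.trace + 1 = 0 := by
  have h0 : (M - z • (1 : Matrix (Fin 2) (Fin 2) ℂ)).det = 0 :=
    exists_mulVec_eq_zero_iff.1 ⟨v, hv, by rw [sub_mulVec, h, smul_mulVec, one_mulVec, sub_self]⟩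
  have h1 := hM.2.2
  rw [det_fin_two] at h0 h1
  simp at h0
  rw [trace_fin_two]
  linear_combination h0 - h1

/-- As det M = 1, the characteristic polynomial takes the value 2 - tr M at 1. -/
theorem IsSU.hasEigenvalue_one_iff {M : Matrix (Fin 2) (Fin 2) ℂ} (hM : IsSU M) :
    Module.End.HasEigenvalue (Matrix.toLin' M) 1 ↔ M.trace - 2 = 0 := by
  constructor
  · intro h
    obtain ⟨v, hv⟩ := h.exists_hasEigenvector
    have h1 := hv.apply_eq_smul
    rw [toLin'_apply] at h1
    linear_combination -hM.trace_of_mulVec hv.2 h1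
  · intro h
    have h1 := hM.2.2
    rw [det_fin_two] at h1
    rw [trace_fin_two] at h
    have h0 : (M - 1).det = 0 := by
      rw [det_fin_two]
      simp
      linear_combination h1 - h
    obtain ⟨v, hv, h2⟩ := exists_mulVec_eq_zero_iff.2 h0
    refine Module.End.hasEigenvalue_of_hasEigenvector (x := v) ⟨?_, hv⟩
    rw [sub_mulVec, one_mulVec, sub_eq_zero] at h2
    rw [Module.End.mem_eigenspace_iff, toLin'_apply, h2, one_smul]

theorem IsSU.trace_eq_re {M : Matrix (Fin 2) (Fin 2) ℂ} (hM : IsSU M) :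
    M.trace = (M.trace.re : ℂ) := by
  rw [trace_fin_two, hM.1, Complex.add_conj]
  simp

theorem analyticOnNhd_trace :
    AnalyticOnNhd ℝ (fun σ => (polygonMatrix α ℓ σ).trace) Set.univ := by
  have h : ∀ σ i, polygonMatrix α ℓ σ i i =
      monodromy (transfer α ℓ σ) n (Pi.single i 1) i := fun σ i => by
    rw [← toLin'_polygonMatrix, toLin'_apply, mulVec_single_one]; rfl
  intro σ _
  simp only [trace_fin_two, h]
  exact (analyticVec_monodromy _ n 0 σ trivial).add (analyticVec_monodromy _ n 1 σ trivial)

theorem phaseVec_add_nat_mul (φ : ℝ) (k : ℕ) :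
    phaseVec (φ + k * (2 * Real.pi)) = phaseVec φ := by
  apply ext_dval_nval
  · rw [dval_phaseVec, dval_phaseVec, Real.cos_add_nat_mul_two_pi]
  · rw [nval_phaseVec, nval_phaseVec, Real.sin_add_nat_mul_two_pi]

theorem phaseVec_pi : phaseVec Real.pi = (-1 : ℂ) • phaseVec 0 := by
  apply ext_dval_nval
  · rw [map_smul, dval_phaseVec, dval_phaseVec]; simp
  · rw [map_smul, nval_phaseVec, nval_phaseVec]; simp

/-- Follow the image of `phaseVec 0`. When its phase is a multiple of 2π, it is an eigenvector with
eigenvalue r > 0, so the trace r + 1/r is at least 2; when the phase is π modulo 2π, the eigenvalue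
is -r and the trace at most -2. Both happen for arbitrarily large σ, and the real continuous trace
takes the value 2 in between. -/
theorem trace_zeros (hα : ∀ j, 0 < α j) (hℓ : ∀ j, 0 < ℓ j) (hex : ∀ j, ¬IsExceptional (α j)) :
    (∀ R, ∃ σ > R, (polygonMatrix α ℓ σ).trace - 2 = 0) ∧
      ∃ σ, (polygonMatrix α ℓ σ).trace - 2 ≠ 0 := by
  obtain ⟨c, -, hc, θ, r, C, hθ, hr, hC, hg⟩ := hasPhase_monodromy hα hℓ hex 0 n
  beta_reduce at hg
  have hm := hc (NeZero.pos n)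
  have hv0 : phaseVec 0 ≠ 0 := fun h => by simpa [phaseVec] using congrFun h 0
  have hM := fun σ => isSU_polygonMatrix (ℓ := ℓ) hα hex σ
  have hT : ∀ σ, polygonMatrix α ℓ σ *ᵥ phaseVec 0 = (r σ : ℂ) • phaseVec (θ σ) := fun σ => by
    rw [← toLin'_apply, toLin'_polygonMatrix, hg, one_mul]
  have hi : ∀ R, ∃ σ > R, 2 ≤ (polygonMatrix α ℓ σ).trace.re := by
    intro R
    obtain ⟨T, h⟩ := exists_phase_eq hθ hm hC R
    obtain ⟨k, hk⟩ := exists_nat_mul_pi_ge T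
    obtain ⟨σ, hσ, he⟩ := h (0 + k * (2 * Real.pi)) (by linarith)
    refine ⟨σ, hσ, ?_⟩
    have h1 := hT σ
    rw [he, phaseVec_add_nat_mul] at h1
    have h2 := (hM σ).trace_of_mulVec hv0 h1
    rw [(hM σ).trace_eq_re] at h2
    have h3 : r σ ^ 2 - r σ * (polygonMatrix α ℓ σ).trace.re + 1 = 0 := by exact_mod_cast h2
    have h4 := hr σ
    by_contra! hlt
    nlinarith [sq_nonneg (r σ - 1), mul_lt_mul_of_pos_left hlt h4]
  have lo : ∀ R, ∃ σ > R, (polygonMatrix α ℓ σ).trace.re ≤ -2 := by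
    intro R
    obtain ⟨T, h⟩ := exists_phase_eq hθ hm hC R
    obtain ⟨k, hk⟩ := exists_nat_mul_pi_ge T
    obtain ⟨σ, hσ, he⟩ := h (Real.pi + k * (2 * Real.pi)) (by linarith [Real.pi_pos])
    refine ⟨σ, hσ, ?_⟩
    have h1 := hT σ
    rw [he, phaseVec_add_nat_mul, phaseVec_pi, smul_smul] at h1
    have h2 := (hM σ).trace_of_mulVec hv0 h1
    rw [(hM σ).trace_eq_re] at h2
    have h3 : (r σ * -1) ^ 2 - (r σ * -1) * (polygonMatrix α ℓ σ).trace.re + 1 = 0 := by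
      exact_mod_cast h2
    have h4 := hr σ
    by_contra! hlt
    nlinarith [sq_nonneg (r σ - 1), mul_lt_mul_of_pos_left hlt h4]
  have cont : Continuous fun σ => (polygonMatrix α ℓ σ).trace.re :=
    Complex.continuous_re.comp (continuousOn_univ.1 analyticOnNhd_trace.continuousOn)
  refine ⟨fun R => ?_, ?_⟩
  · obtain ⟨σ₁, h1, h2⟩ := lo R
    obtain ⟨σ₂, h3, h4⟩ := hi σ₁
    obtain ⟨σ, hσ, he⟩ := intermediate_value_Icc (le_of_lt h3) cont.continuousOn
      (show (2 : ℝ) ∈ _ from ⟨by linarith, h4⟩)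
    refine ⟨σ, lt_of_lt_of_le h1 hσ.1, ?_⟩
    rw [(hM σ).trace_eq_re, show (polygonMatrix α ℓ σ).trace.re = 2 from he]
    norm_num
  · obtain ⟨σ, -, h⟩ := lo 0
    refine ⟨σ, fun h0 => ?_⟩
    have := congrArg Complex.re h0
    simp at this
    linarith

theorem exists_quasiEigenvalue_gt (hα : ∀ j, 0 < α j) (hℓ : ∀ j, 0 < ℓ j) (R : ℝ) :
    ∃ σ > R, IsQuasiEigenvalue α ℓ σ := by
  by_cases hex : ∃ j, IsExceptional (α j)
  · obtain ⟨s, hs⟩ := hex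
    obtain ⟨σ, hσ, h⟩ := (componentEq_zeros hα hℓ hs).1 (max R 0)
    refine ⟨σ, (le_max_left _ _).trans_lt hσ, ?_⟩
    rw [isQuasiEigenvalue_iff_of_exists ⟨s, hs⟩ ((le_max_right R 0).trans hσ.le)]
    exact ⟨s, hs, (solvesComponent_iff hs σ).2 h⟩
  · obtain ⟨σ, hσ, h⟩ := (trace_zeros hα hℓ (not_exists.1 hex)).1 (max R 0)
    refine ⟨σ, (le_max_left _ _).trans_lt hσ, ?_⟩
    rw [isQuasiEigenvalue_iff_of_not hex ((le_max_right R 0).trans hσ.le),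
      (isSU_polygonMatrix hα (not_exists.1 hex) σ).hasEigenvalue_one_iff]
    exact h

theorem finite_quasiEigenvalue_le (hα : ∀ j, 0 < α j) (hℓ : ∀ j, 0 < ℓ j) (R : ℝ) :
    {σ | IsQuasiEigenvalue α ℓ σ ∧ σ ≤ R}.Finite := by
  by_cases hex : ∃ j, IsExceptional (α j)
  · have : (⋃ s ∈ {s | IsExceptional (α s)},
        {σ | σ ∈ Set.Icc 0 R ∧ componentEq α ℓ s σ = 0}).Finite :=
      (Set.toFinite _).biUnion fun s hs =>
        finite_zeros (analyticOnNhd_componentEq s) (componentEq_zeros hα hℓ hs).2 R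
    refine this.subset ?_
    rintro σ ⟨hσ, hR⟩
    obtain ⟨s, hs, h⟩ := (isQuasiEigenvalue_iff_of_exists hex hσ.1).1 hσ
    exact Set.mem_biUnion hs ⟨⟨hσ.1, hR⟩, (solvesComponent_iff hs σ).1 h⟩
  · refine (finite_zeros (f := fun σ => (polygonMatrix α ℓ σ).trace - 2)
      (analyticOnNhd_trace.sub analyticOnNhd_const)
      (trace_zeros hα hℓ (not_exists.1 hex)).2 R).subset ?_
    rintro σ ⟨hσ, hR⟩
    refine ⟨⟨hσ.1, hR⟩, ?_⟩
    rw [isQuasiEigenvalue_iff_of_not hex hσ.1,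
      (isSU_polygonMatrix hα (not_exists.1 hex) σ).hasEigenvalue_one_iff] at hσ
    exact hσ

theorem quasiMultiplicity_pos {σ : ℝ} (hσ : 0 < σ) (h : IsQuasiEigenvalue α ℓ σ) :
    0 < quasiMultiplicity α ℓ σ := by
  rw [quasiMultiplicity, if_pos h]
  by_cases hex : ∃ j, IsExceptional (α j)
  · rw [if_pos hex, if_neg hσ.ne', Set.ncard_pos]
    exact (isQuasiEigenvalue_iff_of_exists hex hσ.le).1 h
  · rw [if_neg hex, if_neg hσ.ne', Module.finrank_pos_iff, Submodule.nontrivial_iff_ne_bot]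
    exact Module.End.hasEigenvalue_iff.1 ((isQuasiEigenvalue_iff_of_not hex hσ.le).1 h)

end Distribution

/-! ### Sequences with prescribed multiplicities -/

/-- A locally finite, unbounded distribution of multiplicities is listed by a monotone sequence. -/
theorem exists_monotone_encard_eq {μ : ℝ → ℕ} (hfin : ∀ R, {x | μ x ≠ 0 ∧ x ≤ R}.Finite)
    (hinf : ∀ R, ∃ x > R, μ x ≠ 0) :
    ∃ σ : ℕ → ℝ, Monotone σ ∧ (∀ x, {m | σ m = x}.encard = μ x) ∧
      Filter.Tendsto σ Filter.atTop Filter.atTop := by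
  -- The copies (x, k) with k < μ x, in lexicographic order. Initial segments are finite and there
  -- is no maximum, so this order is isomorphic to ℕ; the first coordinate of the enumeration is the
  -- sequence sought.
  let ι := {p : ℝ ×ₗ ℕ // (ofLex p).2 < μ (ofLex p).1}
  have hIic : ∀ q : ι, (Set.Iic q).Finite := by
    intro q
    have h1 : (⋃ x ∈ {x | μ x ≠ 0 ∧ x ≤ (ofLex q.1).1},
        (fun k => toLex (x, k)) '' Set.Iio (μ x)).Finite :=
      (hfin _).biUnion fun x _ => (Set.finite_Iio _).image _
    refine (h1.preimage (Subtype.val_injective.injOn)).subset fun p hp => ?_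
    refine Set.mem_biUnion (x := (ofLex p.1).1) ⟨?_, ?_⟩ ⟨(ofLex p.1).2, p.2, rfl⟩
    · have := p.2; omega
    · exact Prod.Lex.monotone_fst _ _ hp
  have exists_gt : ∀ R, ∃ p : ι, R < (ofLex p.1).1 := fun R => by
    obtain ⟨x, hx, h⟩ := hinf R
    exact ⟨⟨toLex (x, 0), Nat.pos_of_ne_zero h⟩, hx⟩
  obtain ⟨p₀, -⟩ := exists_gt 0
  let _ : LocallyFiniteOrder ι := LocallyFiniteOrder.ofFiniteIcc fun a b =>
    (hIic b).subset Set.Icc_subset_Iic_self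
  let _ : SuccOrder ι := LinearLocallyFiniteOrder.succOrder ι
  let _ : PredOrder ι := LinearLocallyFiniteOrder.predOrder ι
  have : NoMaxOrder ι := ⟨fun p => by
    obtain ⟨q, hq⟩ := exists_gt (ofLex p.1).1
    exact ⟨q, Prod.Lex.toLex_lt_toLex.2 (Or.inl hq)⟩⟩
  obtain ⟨b, hb, hmin⟩ := (hIic p₀).exists_minimal ⟨p₀, Set.self_mem_Iic⟩
  let _ : OrderBot ι :=
    { bot := b
      bot_le := fun p => by
        rcases le_total p p₀ with h | h
        · rcases le_total b p with h' | h'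
          · exact h'
          · exact hmin h h'
        · exact le_trans hb h }
  let e : ι ≃o ℕ := orderIsoNatOfLinearSuccPredArch
  have hmono : Monotone fun m => (ofLex (e.symm m).1).1 := fun a b hab =>
    Prod.Lex.monotone_fst _ _ (e.symm.monotone hab)
  refine ⟨fun m => (ofLex (e.symm m).1).1, hmono, fun x => ?_, ?_⟩
  · have himg : {m | (ofLex (e.symm m).1).1 = x} =
        Set.range fun k : Fin (μ x) => e ⟨toLex (x, (k : ℕ)), k.2⟩ := by
      ext m
      constructor
      · intro hm
        obtain ⟨p, rfl⟩ := e.surjective m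
        rw [Set.mem_ofPred_eq, OrderIso.symm_apply_apply] at hm
        subst hm
        exact ⟨⟨(ofLex p.1).2, p.2⟩, rfl⟩
      · rintro ⟨k, rfl⟩
        simp
    have hinj : Function.Injective fun k : Fin (μ x) => e ⟨toLex (x, (k : ℕ)), k.2⟩ := by
      intro k k' h
      have h1 := congrArg (fun p : ι => (ofLex p.1).2) (e.injective h)
      exact Fin.ext h1
    rw [himg, ← Set.image_univ, hinj.encard_image, Set.encard_univ]
    simp
  · refine Filter.tendsto_atTop_atTop_of_monotone hmono fun R => ?_
    obtain ⟨p, hp⟩ := exists_gt R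
    exact ⟨e p, by simpa using hp.le⟩

/-- A monotone sequence is determined by its multiplicities. -/
theorem eq_of_encard_eq {a b : ℕ → ℝ} (ha : Monotone a) (hb : Monotone b)
    (h : ∀ x, {m | a m = x}.encard = {m | b m = x}.encard) : a = b := by
  -- Pigeonhole: equal multiplicities give an injection g of indices with b (g k) = a k. If a m < b
  -- m, it would send the m + 1 indices up to m into the m indices below m.
  have key : ∀ {a b : ℕ → ℝ}, Monotone a → Monotone b →
      (∀ x, {m | a m = x}.encard = {m | b m = x}.encard) → ∀ m, b m ≤ a m := by
    intro a b ha hb h m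
    by_contra! hlt
    have hemb : ∀ x, Nonempty ({m | a m = x} ↪ {m | b m = x}) := fun x =>
      (Cardinal.toENat_le_iff_of_le_aleph0 Cardinal.mk_le_aleph0).1 (h x).le
    let f := fun x => (hemb x).some
    let g : ℕ → ℕ := fun k => f (a k) ⟨k, rfl⟩
    have hg : ∀ k, b (g k) = a k := fun k => (f (a k) ⟨k, rfl⟩).2
    have hgf : ∀ x k (hk : a k = x), g k = f x ⟨k, hk⟩ := by rintro x k rfl; rfl
    have hgi : Function.Injective g := fun k k' hk => by
      have h1 : a k = a k' := by rw [← hg k, hk, hg]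
      rw [hgf _ k h1, hgf _ k' rfl] at hk
      exact congrArg Subtype.val ((f (a k')).injective (Subtype.ext hk))
    have hsub : (Finset.range (m + 1)).image g ⊆ Finset.range m := by
      intro j hj
      obtain ⟨k, hk, rfl⟩ := Finset.mem_image.1 hj
      rw [Finset.mem_range] at hk ⊢
      by_contra! hge
      have h1 := hb hge
      have h2 := ha (Nat.lt_succ_iff.1 hk)
      rw [hg] at h1
      linarith
    have := Finset.card_le_card hsub
    rw [Finset.card_image_of_injective _ hgi, Finset.card_range, Finset.card_range] at this
    omega
  exact funext fun m => le_antisymm (key hb ha (fun x => (h x).symm) m) (key ha hb h m)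

/-! ### Comparison of the two sequences. -/

section Spectrum

variable {n : ℕ} [NeZero n] {α ℓ : Fin n → ℝ}

theorem nonneg_of_isQuasiEigenvalueSeq {σ : ℕ → ℝ} (h : IsQuasiEigenvalueSeq α ℓ σ) (m : ℕ) :
    0 ≤ σ m := by
  by_contra! hlt
  have h1 := h.2 (σ m)
  have h2 : quasiMultiplicity α ℓ (σ m) = 0 := by
    rw [quasiMultiplicity, if_neg fun hq => hlt.not_ge hq.1]
  rw [h2, Nat.cast_zero, Set.encard_eq_zero] at h1
  exact Set.notMem_empty m (h1 ▸ (rfl : σ m = σ m))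

/-- Squaring is injective on nonnegative numbers, so multiplicities carry over from x to x²; any z
that is not such a square has a trivial eigenspace and is not in the list. -/
theorem isEigenvalueSeq_sq (hα : ∀ j, 0 < α j) (hℓ : ∀ j, 0 < ℓ j) {σ : ℕ → ℝ}
    (h : IsQuasiEigenvalueSeq α ℓ σ) :
    IsEigenvalueSeq (graphLaplacian α ℓ) fun m => σ m ^ 2 := by
  have h0 := nonneg_of_isQuasiEigenvalueSeq h
  refine ⟨fun a b hab => pow_le_pow_left₀ (h0 a) (h.1 hab) 2, fun z => ?_⟩
  by_cases hz : ∃ x : ℝ, 0 ≤ x ∧ z = (x : ℂ) ^ 2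
  · obtain ⟨x, hx, rfl⟩ := hz
    rw [toENat_rank_eigenspace hℓ, finrank_coefSpace hα hℓ hx, ← h.2 x]
    congr 1
    ext m
    simp only [Set.mem_ofPred_eq]
    norm_cast
    exact pow_left_inj₀ (h0 m) hx two_ne_zero
  · push Not at hz
    rw [eigenspace_eq_bot hℓ hz, rank_bot, map_zero, Set.encard_eq_zero]
    refine Set.eq_empty_of_forall_notMem fun m hm => hz (σ m) (h0 m) ?_
    rw [← (show ((σ m ^ 2 : ℝ) : ℂ) = z from hm), Complex.ofReal_pow]

theorem exists_isQuasiEigenvalueSeq (hα : ∀ j, 0 < α j) (hℓ : ∀ j, 0 < ℓ j) :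
    ∃ σ : ℕ → ℝ, IsQuasiEigenvalueSeq α ℓ σ ∧ Filter.Tendsto σ Filter.atTop Filter.atTop := by
  obtain ⟨σ, h1, h2, h3⟩ := exists_monotone_encard_eq (μ := quasiMultiplicity α ℓ)
    (fun R => (finite_quasiEigenvalue_le hα hℓ R).subset fun x hx => ⟨by
      by_contra hq
      exact hx.1 (by rw [quasiMultiplicity, if_neg hq]), hx.2⟩)
    -- Only positive quasi-eigenvalues are used here, since they have positive multiplicity; their
    -- supply is unbounded.
    (fun R => by
      obtain ⟨x, hx, hq⟩ := exists_quasiEigenvalue_gt hα hℓ (max R 0)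
      exact ⟨x, (le_max_left _ _).trans_lt hx,
        (quasiMultiplicity_pos ((le_max_right R 0).trans_lt hx) hq).ne'⟩)
  exact ⟨σ, ⟨h1, h2⟩, h3⟩

end Spectrum

end SteklovPolygon

end

theorem mainTheorem3 {n : ℕ} [NeZero n] (α ℓ : Fin n → ℝ)
    (hα : ∀ j, α j ∈ Set.Ioo 0 Real.pi) (hℓ : ∀ j, 0 < ℓ j) :
    (∃ σ : ℕ → ℝ, SteklovPolygon.IsQuasiEigenvalueSeq α ℓ σ) ∧
    (∃ ν : ℕ → ℝ, SteklovPolygon.IsEigenvalueSeq (SteklovPolygon.graphLaplacian α ℓ) ν ∧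
      Filter.Tendsto ν Filter.atTop Filter.atTop) ∧
    ∀ σ ν : ℕ → ℝ, SteklovPolygon.IsQuasiEigenvalueSeq α ℓ σ →
      SteklovPolygon.IsEigenvalueSeq (SteklovPolygon.graphLaplacian α ℓ) ν →
      ∀ m, σ m ^ 2 = ν m := by
  have hα0 : ∀ j, 0 < α j := fun j => (hα j).1
  obtain ⟨σ, hσ, hlim⟩ := SteklovPolygon.exists_isQuasiEigenvalueSeq hα0 hℓ
  refine ⟨⟨σ, hσ⟩, ⟨fun m => σ m ^ 2, SteklovPolygon.isEigenvalueSeq_sq hα0 hℓ hσ,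
    (Filter.tendsto_pow_atTop two_ne_zero).comp hlim⟩, fun σ ν hσ hν m => ?_⟩
  have hsq := SteklovPolygon.isEigenvalueSeq_sq hα0 hℓ hσ
  refine congrFun (SteklovPolygon.eq_of_encard_eq hsq.1 hν.1 fun x => ?_) m
  have h1 := (hsq.2 x).trans (hν.2 x).symm
  simpa only [Complex.ofReal_inj] using h1
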